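/- Let $A$ be a finite totally ordered alphabet. Words are finite sequences of letters of $A$; sentences are finite sequences of nonempty words; weak sentences may also contain empty words. A p-sentence is a sentence whose words weakly decrease in the graded lexicographic order (shorter words are smaller, words of equal length are compared lexicographically), and $\mathrm{sort}(I)$ is the p-sentence obtained from a (weak) sentence $I$ by deleting the empty words and sorting the others. Let $x_{a,i}$ ($a\in A$, $i\ge 1$) be variables such that $x_{a,i}$ and $x_{b,j}$ commute when $i\ne j$ (and no other relations hold), and write $x_{w,i}=x_{a_1,i}\cdots x_{a_k,i}$ for a word $w=a_1\cdots a_k$. Every monomial is uniquely $x_{w_1,j_1}\cdots x_{w_m,j_m}$ with $j_1<\cdots<j_m$ and nonempty words $w_i$; it is associated with the sentence $(w_1,\dots,w_m)$. $QSym_A$ is the algebra of formal power series of bounded degree over $\mathbb{Q}$ in these variables in which monomials associated with the same sentence have equal coefficients. It has the basis $M_I=\sum_{j_1<\cdots<j_m}x_{w_1,j_1}\cdots x_{w_m,j_m}$, $I=(w_1,\dots,w_m)$ a sentence, and is a Hopf algebra with coproduct $\Delta(M_I)=\sum_{I=J\cdot K}M_J\otimes M_K$ and with the constant term as counit. $Sym_A\subseteq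 QSym_A$ consists of those $f$ that are invariant under all permutations of the second indices of the variables. For a p-sentence $P$ put $m_P=\sum_{\mathrm{sort}(I)=P}M_I$, summed over sentences $I$. **Theorem.** The $m_P$, $P$ a p-sentence, form a basis of $Sym_A$. $Sym_A$ is a Hopf subalgebra of $QSym_A$ (the product, coproduct and antipode of $QSym_A$ restrict to it), and it is a Hopf algebra graded by degree, with product $$m_P\,m_S=\sum_{Q}r^{Q}_{P,S}\,m_Q,$$ where $Q$ runs over p-sentences and $r^Q_{P,S}$ is the number of pairs of weak sentences $Y=(y_1,\dots,y_m)$, $Z=(z_1,\dots,z_m)$ with $m=\ell(Q)$ (the number of words of $Q$), $\mathrm{sort}(Y)=P$, $\mathrm{sort}(Z)=S$ and $Q=(y_1z_1,\dots,y_mz_m)$ (only finitely many of these numbers are nonzero for given $P,S$); with unit $u(k)=k\cdot 1$; with coproduct $$\Delta(m_P)=\sum_{Q\sqsubseteq P}m_Q\otimes m_{P\setminus\!\setminus Q},$$ where $Q\sqsubseteq P$ means that the words of the p-sentence $Q$ form a submultiset of the words of $P$, and $P\setminus\!\setminus Q$ is the p-sentence formed by the remaining words; and with counit $\epsilon(m_P)=1$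 if $P=\emptyset$ and $\epsilon(m_P)=0$ otherwise. -/

import Mathlib

open scoped TensorProduct

noncomputable section

namespace ColoredSym

/-! ### Words, weak sentences and sentences -/

/-- Words in the alphabet `A`; the empty word is `[]`, concatenation is `++`. -/
abbrev Word (A : Type*) := List A

/-- Weak sentences of infinite length: sequences of words, all but finitely many of them empty.
The weak sentence `K` stands for the monomial `x_K = ∏ i, x_{K i, i}` in the variables `x_{a,i}`,
`a ∈ A`, where `x_{a,i}` and `x_{b,j}` commute for `i ≠ j`, and where `x_{w,i}` is the ordered
product of the `x_{a,i}` over the letters `a` of the word `w`. -/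
@[ext] structure WSent (A : Type*) where
  /-- the `i`-th word -/
  word : ℕ → Word A
  finite : {i | word i ≠ []}.Finite

variable {A : Type*}

/-- The product of monomials concatenates the words that belong to the same index. -/
instance : Monoid (WSent A) where
  mul K L := ⟨fun i => K.word i ++ L.word i, (K.finite.union L.finite).subset fun i hi => by
    by_contra h
    simp only [Set.mem_union, Set.mem_ofPred_eq, not_or, not_not] at h
    exact hi (by simp [h.1, h.2])⟩
  one := ⟨fun _ => [], by simp⟩
  mul_assoc K L N := WSent.ext (funext fun _ => List.append_assoc _ _ _)
  one_mul K := WSent.ext (funext fun _ => List.nil_append _)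
  mul_one K := WSent.ext (funext fun _ => List.append_nil _)

theorem WSent.mul_apply (K L : WSent A) (i : ℕ) : (K * L).word i = K.word i ++ L.word i := rfl

theorem WSent.one_apply (i : ℕ) : (1 : WSent A).word i = [] := rfl

/-- The set of indices of the nonempty words. -/
def WSent.supp (K : WSent A) : Finset ℕ := K.finite.toFinset

theorem WSent.mem_supp (K : WSent A) (i : ℕ) : i ∈ K.supp ↔ K.word i ≠ [] := by
  simp [WSent.supp]

/-- The size of a weak sentence: its number of letters. -/
def WSent.size (K : WSent A) : ℕ := ∑ i ∈ K.supp, (K.word i).length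

/-- Sentences: finite sequences of nonempty words. -/
@[ext] structure Sent (A : Type*) where
  /-- the list of words -/
  words : List (Word A)
  nil_notMem : [] ∉ words

/-- The size of a sentence: its number of letters. -/
def Sent.size (I : Sent A) : ℕ := (I.words.map List.length).sum

/-- The sentence obtained from a weak sentence by removing the empty words: the sentence
associated with the monomial `x_K`. -/
def WSent.flatten (K : WSent A) : Sent A :=
  ⟨(K.supp.sort (· ≤ ·)).map K.word, by
    intro h
    obtain ⟨i, hi, hK⟩ := List.mem_map.1 h
    exact (K.mem_supp i).1 ((Finset.mem_sort _).1 hi) hK⟩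

theorem WSent.size_flatten (K : WSent A) : K.flatten.size = K.size := by
  have h := List.sum_toFinset (fun i => (K.word i).length) (Finset.sort_nodup K.supp (· ≤ ·))
  rw [Finset.sort_toFinset] at h
  simp only [Sent.size, WSent.flatten, WSent.size, List.map_map]
  rw [h]; rfl

/-- The weak sentence `(w₁, …, wₘ, ∅, ∅, …)`. -/
def Sent.toWSent (I : Sent A) : WSent A :=
  ⟨fun i => I.words.getD i [], (Set.finite_lt_nat I.words.length).subset fun i hi => by
    by_contra h
    exact hi (by simp only [Set.mem_ofPred_eq, not_lt] at h; simp [h])⟩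

theorem Sent.flatten_toWSent (I : Sent A) : I.toWSent.flatten = I := by
  have hs : I.toWSent.supp = Finset.range I.words.length := by
    ext i
    rw [WSent.mem_supp, Finset.mem_range]
    constructor
    · intro h
      by_contra hi
      exact h (by simp [Sent.toWSent, not_lt.1 hi])
    · intro h h0
      apply I.nil_notMem
      simp only [Sent.toWSent, List.getD_eq_getElem _ _ h] at h0
      rw [← h0]
      exact List.getElem_mem h
  apply Sent.ext
  simp only [WSent.flatten, hs]
  apply List.ext_getElem
  · simp
  · intro i h1 h2
    simp [Sent.toWSent, h2]

theorem finite_factor (K : WSent A) : {p : WSent A × WSent A | p.1 * p.2 = K}.Finite := by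
  rw [← Set.finite_coe_iff]
  have key : ∀ p : {p : WSent A × WSent A | p.1 * p.2 = K}, ∀ i,
      p.1.1.1 i ++ p.1.2.1 i = K.word i := fun p i => by
    have h : p.1.1 * p.1.2 = K := p.2
    exact congrArg (fun N : WSent A => N.word i) h
  refine Finite.of_injective (β := ∀ i : K.supp, Fin ((K.word i).length + 1))
    (fun p i => ⟨(p.1.1.1 i).length, by rw [← key p i]; simp⟩) ?_
  intro p q h
  have hlen : ∀ i, (p.1.1.1 i).length = (q.1.1.1 i).length := by
    intro i
    by_cases hi : i ∈ K.supp
    · simpa using congrArg Fin.val (congrFun h ⟨i, hi⟩)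
    · have h0 : K.word i = [] := by simpa [WSent.mem_supp] using hi
      have hp := key p i
      have hq := key q i
      rw [h0, List.append_eq_nil_iff] at hp hq
      rw [hp.1, hq.1]
  have happ : ∀ i, p.1.1.1 i = q.1.1.1 i ∧ p.1.2.1 i = q.1.2.1 i := fun i =>
    List.append_inj ((key p i).trans (key q i).symm) (hlen i)
  exact Subtype.ext (Prod.ext (WSent.ext (funext fun i => (happ i).1))
    (WSent.ext (funext fun i => (happ i).2)))

/-- The finite set of all factorizations `x_Y x_Z = x_K`. -/
def factor (K : WSent A) : Finset (WSent A × WSent A) := (finite_factor K).toFinset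

theorem mem_factor {K : WSent A} {p : WSent A × WSent A} : p ∈ factor K ↔ p.1 * p.2 = K := by
  simp [factor]

/-! ### Formal power series in the partially commuting variables -/

/-- Formal power series `∑ K, f K • x_K` with rational coefficients. -/
def Series (A : Type*) := WSent A → ℚ

namespace Series

instance : AddCommGroup (Series A) := inferInstanceAs (AddCommGroup (WSent A → ℚ))
instance : Module ℚ (Series A) := inferInstanceAs (Module ℚ (WSent A → ℚ))

instance : Mul (Series A) := ⟨fun f g K => ∑ p ∈ factor K, f p.1 * g p.2⟩

open Classical in
instance : One (Series A) := ⟨fun K => if K = 1 then 1 else 0⟩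

@[ext] theorem ext {f g : Series A} (h : ∀ K, f K = g K) : f = g := funext h
theorem add_apply (f g : Series A) (K) : (f + g) K = f K + g K := rfl
theorem zero_apply (K) : (0 : Series A) K = 0 := rfl
theorem neg_apply (f : Series A) (K) : (-f) K = -f K := rfl
theorem smul_apply (c : ℚ) (f : Series A) (K) : (c • f) K = c * f K := rfl
theorem mul_apply (f g : Series A) (K) : (f * g) K = ∑ p ∈ factor K, f p.1 * g p.2 := rfl
open Classical in
theorem one_apply (K : WSent A) : (1 : Series A) K = if K = 1 then 1 else 0 := rfl

protected theorem mul_assoc (f g h : Series A) : f * g * h = f * (g * h) := by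
  ext K
  simp only [mul_apply, Finset.sum_mul, Finset.mul_sum]
  rw [Finset.sum_sigma', Finset.sum_sigma']
  refine Finset.sum_bij'
    (fun x _ => (⟨(x.2.1, x.2.2 * x.1.2), (x.2.2, x.1.2)⟩ :
      (_ : WSent A × WSent A) × (WSent A × WSent A)))
    (fun x _ => (⟨(x.1.1 * x.2.1, x.2.2), (x.1.1, x.2.1)⟩ :
      (_ : WSent A × WSent A) × (WSent A × WSent A))) ?_ ?_ ?_ ?_ ?_
  · rintro ⟨⟨a, b⟩, ⟨c, d⟩⟩ hx
    simp only [Finset.mem_sigma, mem_factor] at hx ⊢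
    obtain ⟨rfl, rfl⟩ := hx
    simp [mul_assoc]
  · rintro ⟨⟨a, b⟩, ⟨c, d⟩⟩ hx
    simp only [Finset.mem_sigma, mem_factor] at hx ⊢
    obtain ⟨rfl, rfl⟩ := hx
    simp [mul_assoc]
  · rintro ⟨⟨a, b⟩, ⟨c, d⟩⟩ hx
    simp only [Finset.mem_sigma, mem_factor] at hx
    obtain ⟨rfl, rfl⟩ := hx
    rfl
  · rintro ⟨⟨a, b⟩, ⟨c, d⟩⟩ hx
    simp only [Finset.mem_sigma, mem_factor] at hx
    obtain ⟨rfl, rfl⟩ := hx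
    rfl
  · rintro ⟨⟨a, b⟩, ⟨c, d⟩⟩ hx
    exact _root_.mul_assoc _ _ _

protected theorem one_mul (f : Series A) : 1 * f = f := by
  ext K
  rw [mul_apply, Finset.sum_eq_single (1, K)]
  · simp [one_apply]
  · rintro ⟨a, b⟩ hp hne
    rw [mem_factor] at hp
    have : a ≠ 1 := by
      rintro rfl
      exact hne (by simpa using hp)
    simp [one_apply, this]
  · intro h
    exact absurd (mem_factor.2 (one_mul K)) h

protected theorem mul_one (f : Series A) : f * 1 = f := by
  ext K
  rw [mul_apply, Finset.sum_eq_single (K, 1)]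
  · simp [one_apply]
  · rintro ⟨a, b⟩ hp hne
    rw [mem_factor] at hp
    have : b ≠ 1 := by
      rintro rfl
      exact hne (by simpa using hp)
    simp [one_apply, this]
  · intro h
    exact absurd (mem_factor.2 (mul_one K)) h

instance : Ring (Series A) :=
  { (inferInstance : AddCommGroup (Series A)) with
    mul := (· * ·)
    one := 1
    mul_assoc := Series.mul_assoc
    one_mul := Series.one_mul
    mul_one := Series.mul_one
    left_distrib := fun f g h => by
      ext K; simp only [mul_apply, add_apply, mul_add, Finset.sum_add_distrib]
    right_distrib := fun f g h => by
      ext K; simp only [mul_apply, add_apply, add_mul, Finset.sum_add_distrib]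
    zero_mul := fun f => by ext K; simp [mul_apply, zero_apply]
    mul_zero := fun f => by ext K; simp [mul_apply, zero_apply] }

instance : Algebra ℚ (Series A) :=
  Algebra.ofModule
    (fun r f g => by
      ext K; simp only [mul_apply, smul_apply, Finset.mul_sum, mul_assoc])
    (fun r f g => by
      ext K; simp only [mul_apply, smul_apply, Finset.mul_sum]
      exact Finset.sum_congr rfl fun _ _ => by ring)

/-- Bounded degree. -/
def IsBounded (f : Series A) : Prop := ∃ n : ℕ, ∀ K, f K ≠ 0 → K.size ≤ n

/-- Quasisymmetry: monomials associated with the same sentence have equal coefficients. -/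
def IsQuasiSymm (f : Series A) : Prop := ∀ K L : WSent A, K.flatten = L.flatten → f K = f L

/-- Symmetry: `f(x_{A,1}, x_{A,2}, …) = f(x_{A,σ(1)}, x_{A,σ(2)}, …)` for all permutations `σ`. -/
def IsSymm (f : Series A) : Prop :=
  ∀ (σ : Equiv.Perm ℕ) (K L : WSent A), (∀ i, L.word i = K.word (σ i)) → f K = f L

end Series

/-! ### The algebra of colored quasisymmetric functions -/

/-- The sentence of `Y` can be read off along any increasing list that contains its support. -/
theorem WSent.flatten_words_eq (Y : WSent A) (s : List ℕ) (hs : s.Pairwise (· < ·))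
    (hY : ∀ i, Y.word i ≠ [] → i ∈ s) :
    Y.flatten.words = (s.map Y.word).filter (fun w => !w.isEmpty) := by
  have h1 : Y.supp.sort (· ≤ ·) = s.filter (fun i => !(Y.word i).isEmpty) := by
    refine List.Perm.eq_of_pairwise (le := (· ≤ ·)) (fun a b _ _ h h' => le_antisymm h h')
      (Finset.pairwise_sort _ _) ((hs.imp le_of_lt).filter _) ?_
    refine (List.perm_ext_iff_of_nodup (Finset.sort_nodup _ _)
      ((hs.imp ne_of_lt).filter _)).2 fun i => ?_
    rw [Finset.mem_sort, WSent.mem_supp, List.mem_filter]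
    constructor
    · intro h
      exact ⟨hY i h, by simpa using h⟩
    · intro h
      simpa using h.2
  simp only [WSent.flatten, h1, List.filter_map]
  rfl

theorem Series.IsQuasiSymm.apply_toWSent {f : Series A} (hf : f.IsQuasiSymm) (K : WSent A) :
    f K.flatten.toWSent = f K := hf _ _ (Sent.flatten_toWSent _)

theorem Series.IsQuasiSymm.mul {f g : Series A} (hf : f.IsQuasiSymm) (hg : g.IsQuasiSymm) :
    (f * g).IsQuasiSymm := by
  suffices h : ∀ K : WSent A, (f * g) K = (f * g) K.flatten.toWSent from
    fun K L hKL => by rw [h K, h L, hKL]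
  intro K
  set s := K.supp.sort (· ≤ ·) with hsdef
  have hsmem : ∀ i, i ∈ s ↔ K.word i ≠ [] := fun i => by
    rw [hsdef, Finset.mem_sort, WSent.mem_supp]
  have hslt : s.Pairwise (· < ·) := Finset.sortedLT_sort K.supp |>.pairwise
  have hnd : s.Nodup := hslt.imp ne_of_lt
  have hC : ∀ i, K.flatten.toWSent.word i = if h : i < s.length then K.word s[i] else [] := by
    intro i
    by_cases h : i < s.length
    · have h' : i < (s.map K.word).length := by simpa using h
      have : (s.map K.word).getD i [] = K.word s[i] := by
        rw [List.getD_eq_getElem _ _ h']; simp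
      rw [dif_pos h]
      exact this
    · have h' : (s.map K.word).length ≤ i := by simpa using h
      have : (s.map K.word).getD i [] = [] := List.getD_eq_default _ _ h'
      rw [dif_neg h]
      exact this
  -- pulling back along `s`, and pushing forward along `s`
  let pull : WSent A → WSent A := fun Y =>
    ⟨fun i => if h : i < s.length then Y.word s[i] else [],
      (Set.finite_lt_nat s.length).subset fun i hi => by
        by_contra h
        exact hi (dif_neg h)⟩
  let push : WSent A → WSent A := fun Y =>
    ⟨fun i => if i ∈ s then Y.word (s.idxOf i) else [],
      s.finite_toSet.subset fun i hi => by
        by_contra h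
        exact hi (if_neg h)⟩
  have hpull_flat : ∀ Y : WSent A, (∀ i, Y.word i ≠ [] → i ∈ s) →
      (pull Y).flatten = Y.flatten := by
    intro Y hY
    apply Sent.ext
    rw [WSent.flatten_words_eq Y s hslt hY,
      WSent.flatten_words_eq (pull Y) (List.range s.length) List.pairwise_lt_range]
    · congr 1
      apply List.ext_getElem
      · simp
      · intro i h1 h2
        have : i < s.length := by simpa using h2
        simp [pull, this]
    · intro i hi
      rw [List.mem_range]
      by_contra h
      exact hi (dif_neg h)
  have hpush_pull : ∀ Y : WSent A, (∀ i, Y.word i ≠ [] → i ∈ s) → push (pull Y) = Y := by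
    intro Y hY
    apply WSent.ext
    funext i
    by_cases hi : i ∈ s
    · have := List.idxOf_lt_length_of_mem hi
      simp [push, pull, hi, this]
    · have : Y.word i = [] := by
        by_contra h
        exact hi (hY i h)
      simp [push, hi, this]
  have hpull_push : ∀ Y : WSent A, (∀ i, Y.word i ≠ [] → i < s.length) → pull (push Y) = Y := by
    intro Y hY
    apply WSent.ext
    funext i
    by_cases hi : i < s.length
    · simp [push, pull, hi, hnd.idxOf_getElem]
    · have : Y.word i = [] := by
        by_contra h
        exact hi (hY i h)
      simp [pull, hi, this]
  have hfac : ∀ p ∈ factor K, (∀ i, p.1.word i ≠ [] → i ∈ s) ∧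
      (∀ i, p.2.word i ≠ [] → i ∈ s) := by
    intro p hp
    rw [mem_factor] at hp
    subst hp
    constructor <;> intro i hi <;> rw [hsmem, WSent.mul_apply] <;> simp [hi]
  have hfac' : ∀ p ∈ factor K.flatten.toWSent, (∀ i, p.1.word i ≠ [] → i < s.length) ∧
      (∀ i, p.2.word i ≠ [] → i < s.length) := by
    intro p hp
    rw [mem_factor] at hp
    constructor <;> intro i hi <;> by_contra h <;> have h0 := hC i <;>
      rw [dif_neg h, ← hp, WSent.mul_apply, List.append_eq_nil_iff] at h0
    · exact hi h0.1
    · exact hi h0.2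
  rw [mul_apply, mul_apply]
  refine Finset.sum_bij' (fun p _ => (pull p.1, pull p.2)) (fun p _ => (push p.1, push p.2))
    ?_ ?_ ?_ ?_ ?_
  · intro p hp
    rw [mem_factor] at hp ⊢
    apply WSent.ext
    funext i
    rw [WSent.mul_apply, hC]
    by_cases h : i < s.length
    · simp [pull, h, ← hp, WSent.mul_apply]
    · simp [pull, h]
  · intro p hp
    rw [mem_factor] at hp ⊢
    apply WSent.ext
    funext i
    rw [WSent.mul_apply]
    by_cases h : i ∈ s
    · have h2 := List.idxOf_lt_length_of_mem h
      have h0 := hC (s.idxOf i)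
      rw [dif_pos h2, List.getElem_idxOf, ← hp, WSent.mul_apply] at h0
      simp [push, h, h0]
    · have : K.word i = [] := by simpa [hsmem] using h
      simp [push, h, this]
  · intro p hp
    exact Prod.ext (hpush_pull _ (hfac p hp).1) (hpush_pull _ (hfac p hp).2)
  · intro p hp
    exact Prod.ext (hpull_push _ (hfac' p hp).1) (hpull_push _ (hfac' p hp).2)
  · intro p hp
    rw [hf _ _ (hpull_flat _ (hfac p hp).1), hg _ _ (hpull_flat _ (hfac p hp).2)]

theorem WSent.size_eq_sum (K : WSent A) (s : Finset ℕ) (hs : K.supp ⊆ s) :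
    K.size = ∑ i ∈ s, (K.word i).length :=
  Finset.sum_subset hs fun i _ hi => by simpa [WSent.mem_supp] using hi

theorem WSent.size_mul (K L : WSent A) : (K * L).size = K.size + L.size := by
  have h : (K * L).supp = K.supp ∪ L.supp := by
    ext i
    simp only [WSent.mem_supp, Finset.mem_union, WSent.mul_apply, ne_eq, List.append_eq_nil_iff]
    tauto
  rw [WSent.size_eq_sum (K * L) (K.supp ∪ L.supp) h.subset,
    WSent.size_eq_sum K (K.supp ∪ L.supp) Finset.subset_union_left,
    WSent.size_eq_sum L (K.supp ∪ L.supp) Finset.subset_union_right, ← Finset.sum_add_distrib]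
  simp [WSent.mul_apply]

theorem Series.IsBounded.mul {f g : Series A} (hf : f.IsBounded) (hg : g.IsBounded) :
    (f * g).IsBounded := by
  obtain ⟨m, hm⟩ := hf
  obtain ⟨n, hn⟩ := hg
  refine ⟨m + n, fun K hK => ?_⟩
  rw [mul_apply] at hK
  obtain ⟨p, hp, hne⟩ := Finset.exists_ne_zero_of_sum_ne_zero hK
  rw [← mem_factor.1 hp, WSent.size_mul]
  exact add_le_add (hm _ (left_ne_zero_of_mul hne)) (hn _ (right_ne_zero_of_mul hne))

theorem WSent.flatten_one : (1 : WSent A).flatten = ⟨[], by simp⟩ := by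
  apply Sent.ext
  rw [WSent.flatten_words_eq 1 [] List.Pairwise.nil (by simp [WSent.one_apply])]
  rfl

theorem WSent.flatten_eq_nil {K : WSent A} (h : K.flatten.words = []) : K = 1 := by
  apply WSent.ext
  funext i
  rw [WSent.one_apply]
  by_contra hi
  have : i ∈ K.supp.sort (· ≤ ·) := (Finset.mem_sort _).2 ((K.mem_supp i).2 hi)
  rw [List.map_eq_nil_iff.1 h] at this
  simp at this

/-- The algebra of colored quasisymmetric functions: the formal power series of bounded degree
in which monomials associated with the same sentence have equal coefficients. The product is
that of formal power series. -/
def QSymA (A : Type*) : Subalgebra ℚ (Series A) where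
  carrier := {f | f.IsBounded ∧ f.IsQuasiSymm}
  mul_mem' hf hg := ⟨hf.1.mul hg.1, hf.2.mul hg.2⟩
  add_mem' := by
    rintro f g ⟨⟨m, hm⟩, hf⟩ ⟨⟨n, hn⟩, hg⟩
    refine ⟨⟨max m n, fun K hK => ?_⟩, fun K L h => ?_⟩
    · by_contra hlt
      rw [not_le, max_lt_iff] at hlt
      have h1 : f K = 0 := by
        by_contra h
        exact absurd (hm K h) (not_le.2 hlt.1)
      have h2 : g K = 0 := by
        by_contra h
        exact absurd (hn K h) (not_le.2 hlt.2)
      exact hK (by rw [Series.add_apply, h1, h2, add_zero])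
    · rw [Series.add_apply, Series.add_apply, hf K L h, hg K L h]
  algebraMap_mem' r := by
    classical
    have key : ∀ K : WSent A, algebraMap ℚ (Series A) r K = if K = 1 then r else 0 := fun K => by
      rw [Algebra.algebraMap_eq_smul_one, Series.smul_apply, Series.one_apply]
      simp
    refine ⟨⟨0, fun K hK => ?_⟩, fun K L h => ?_⟩
    · rw [key] at hK
      have : K = 1 := by
        by_contra hne
        simp [hne] at hK
      subst this
      simp [WSent.size, WSent.one_apply]
    · have : K = 1 ↔ L = 1 := by
        constructor
        · rintro rfl
          exact WSent.flatten_eq_nil (by rw [← h, WSent.flatten_one])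
        · rintro rfl
          exact WSent.flatten_eq_nil (by rw [h, WSent.flatten_one])
      rw [key, key]
      simp only [this]

open Classical in
/-- The colored monomial quasisymmetric function: the sum `∑ x_{w₁,j₁} ⋯ x_{wₘ,jₘ}` over
`j₁ < ⋯ < jₘ`, that is, the sum of all monomials associated with `I = (w₁, …, wₘ)`. -/
def M (I : Sent A) : QSymA A :=
  ⟨fun K => if K.flatten = I then 1 else 0,
    ⟨I.size, fun K hK => by
      have h : K.flatten = I := by
        by_contra hne
        exact hK (if_neg hne)
      rw [← K.size_flatten, h]⟩,
    fun K L h => by simp only [h]⟩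

theorem finite_size_le [Finite A] (n : ℕ) : {I : Sent A | I.size ≤ n}.Finite := by
  have : Finite {w : Word A | w.length ≤ n} := (List.finite_length_le A n).to_subtype
  refine Set.Finite.subset (((List.finite_length_le {w : Word A | w.length ≤ n} n).image
    (List.map Subtype.val)).preimage
      (f := Sent.words) (fun I _ J _ h => Sent.ext h)) fun I hI => ?_
  have hI' : (I.words.map List.length).sum ≤ n := hI
  have hw : ∀ w ∈ I.words, w.length ≤ n := fun w hw =>
    (List.single_le_sum (by simp) _ (List.mem_map_of_mem hw)).trans hI'
  refine ⟨I.words.pmap (fun w h => (⟨w, h⟩ : {w : Word A | w.length ≤ n})) hw, ?_, ?_⟩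
  · change List.length _ ≤ n
    rw [List.length_pmap]
    refine le_trans ?_ hI'
    have := List.card_nsmul_le_sum (I.words.map List.length) 1 (fun k hk => by
      obtain ⟨w, hw, rfl⟩ := List.mem_map.1 hk
      rw [Nat.one_le_iff_ne_zero]
      intro h0
      rw [List.length_eq_zero_iff] at h0
      exact I.nil_notMem (h0 ▸ hw))
    simpa using this
  · rw [List.map_pmap]
    exact (List.pmap_eq_map _).trans (List.map_id _)

/-- The functions `M I` form a basis of the colored quasisymmetric functions. -/
def basisM (A : Type*) [Finite A] : Module.Basis (Sent A) ℚ (QSymA A) :=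
  .ofRepr
    { toFun := fun f => Finsupp.ofSupportFinite (fun I => f.1 I.toWSent) (by
        obtain ⟨n, hn⟩ := f.2.1
        refine (finite_size_le n).subset fun I hI => ?_
        have := hn _ hI
        rwa [← WSent.size_flatten, Sent.flatten_toWSent] at this)
      map_add' := fun f g => by ext I; rfl
      map_smul' := fun c f => by ext I; rfl
      invFun := fun c => ⟨fun K => c K.flatten,
        ⟨c.support.sup Sent.size, fun K hK => by
          rw [← K.size_flatten]
          exact Finset.le_sup (f := Sent.size) (Finsupp.mem_support_iff.2 hK)⟩,
        fun K L h => by simp only [h]⟩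
      left_inv := fun f => Subtype.ext (funext fun K => f.2.2.apply_toWSent K)
      right_inv := fun c => by
        ext I
        exact congrArg c I.flatten_toWSent }

theorem basisM_apply [Finite A] (I : Sent A) : basisM A I = M I := by
  classical
  refine Subtype.ext (funext fun K => ?_)
  change Finsupp.single I (1 : ℚ) K.flatten = if K.flatten = I then 1 else 0
  rw [Finsupp.single_apply]
  simp only [eq_comm]

/-! ### The coalgebra structure of the colored quasisymmetric functions -/

/-- The first `k` words of a sentence. -/
def Sent.take (I : Sent A) (k : ℕ) : Sent A :=
  ⟨I.words.take k, fun h => I.nil_notMem (List.mem_of_mem_take h)⟩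

/-- A sentence without its first `k` words. -/
def Sent.drop (I : Sent A) (k : ℕ) : Sent A :=
  ⟨I.words.drop k, fun h => I.nil_notMem (List.mem_of_mem_drop h)⟩

/-- The comultiplication `Δ(M_I) = ∑ M_J ⊗ M_K`, over all sentences with `I = J · K`. -/
def comulQ (A : Type*) [Finite A] : QSymA A →ₗ[ℚ] QSymA A ⊗[ℚ] QSymA A :=
  (basisM A).constr ℚ fun I =>
    ∑ k ∈ Finset.range (I.words.length + 1), M (I.take k) ⊗ₜ[ℚ] M (I.drop k)

/-- The counit: the constant term. -/
def counitQ (A : Type*) : QSymA A →ₗ[ℚ] ℚ where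
  toFun f := f.1 1
  map_add' _ _ := rfl
  map_smul' _ _ := rfl

/-! ### The colored symmetric functions -/

theorem Series.IsSymm.mul {f g : Series A} (hf : f.IsSymm) (hg : g.IsSymm) :
    (f * g).IsSymm := by
  intro σ K L h
  let re : Equiv.Perm ℕ → WSent A → WSent A := fun τ Y =>
    ⟨fun i => Y.word (τ i), Y.finite.preimage τ.injective.injOn⟩
  rw [mul_apply, mul_apply]
  refine Finset.sum_bij' (fun p _ => (re σ p.1, re σ p.2))
    (fun p _ => (re σ.symm p.1, re σ.symm p.2)) ?_ ?_ ?_ ?_ ?_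
  · intro p hp
    rw [mem_factor] at hp ⊢
    apply WSent.ext
    funext i
    rw [h i, ← hp]; rfl
  · intro p hp
    rw [mem_factor] at hp ⊢
    apply WSent.ext
    funext i
    have := h (σ.symm i)
    rw [Equiv.apply_symm_apply] at this
    rw [← this, ← hp]; rfl
  · intro p _
    simp [re]
  · intro p _
    simp [re]
  · intro p _
    rw [hf σ p.1 (re σ p.1) fun _ => rfl, hg σ p.2 (re σ p.2) fun _ => rfl]

/-- The algebra of colored symmetric functions, inside the colored quasisymmetric functions. -/
def SymA (A : Type*) : Subalgebra ℚ (QSymA A) where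
  carrier := {f | f.1.IsSymm}
  mul_mem' hf hg := Series.IsSymm.mul hf hg
  add_mem' hf hg := fun σ K L h => by
    exact congrArg₂ (· + ·) (hf σ K L h) (hg σ K L h)
  algebraMap_mem' r := by
    classical
    intro σ K L h
    have key : ∀ K : WSent A, (algebraMap ℚ (QSymA A) r).1 K = if K = 1 then r else 0 :=
      fun K => by
        change algebraMap ℚ (Series A) r K = _
        rw [Algebra.algebraMap_eq_smul_one, Series.smul_apply, Series.one_apply]
        simp
    have : K = 1 ↔ L = 1 := by
      constructor
      · rintro rfl
        exact WSent.ext (funext fun i => h i)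
      · rintro rfl
        refine WSent.ext (funext fun i => ?_)
        have := h (σ.symm i)
        rw [Equiv.apply_symm_apply] at this
        exact this.symm
    rw [key, key]
    simp only [this]

/-- The homogeneous colored symmetric functions of degree `n`. -/
def SymA.homogeneous (A : Type*) (n : ℕ) : Submodule ℚ (SymA A) where
  carrier := {f | ∀ K, f.1.1 K ≠ 0 → K.size = n}
  add_mem' := by
    intro f g hf hg K hK
    by_contra hne
    have h1 : f.1.1 K = 0 := by
      by_contra h
      exact hne (hf K h)
    have h2 : g.1.1 K = 0 := by
      by_contra h
      exact hne (hg K h)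
    apply hK
    change f.1.1 K + g.1.1 K = 0
    rw [h1, h2, add_zero]
  zero_mem' := fun K hK => absurd rfl hK
  smul_mem' := fun c f hf K hK => hf K (right_ne_zero_of_mul hK)

/-! ### p-sentences -/

section PSent

variable [LinearOrder A]

/-- The graded lexicographic order on words: shorter words come first, and words of the same
length are compared lexicographically. -/
def gl (v w : Word A) : Prop := v.length < w.length ∨ v.length = w.length ∧ v ≤ w

instance (v w : Word A) : Decidable (gl v w) := inferInstanceAs (Decidable (_ ∨ _))

/-- p-sentences: sentences whose words weakly decrease in the graded lexicographic order. -/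
@[ext] structure PSent (A : Type*) [LinearOrder A] where
  /-- the list of words -/
  words : List (Word A)
  nil_notMem : [] ∉ words
  sorted : words.Pairwise fun v w => gl w v

instance : Std.Total fun v w : Word A => gl w v := ⟨fun v w => by
  unfold gl
  rcases lt_trichotomy v.length w.length with h | h | h
  · exact .inr (.inl h)
  · rcases le_total v w with h' | h'
    · exact .inr (.inr ⟨h, h'⟩)
    · exact .inl (.inr ⟨h.symm, h'⟩)
  · exact .inl (.inl h)⟩

instance : IsTrans (Word A) fun v w => gl w v := ⟨fun u v w h1 h2 => by
  unfold gl at *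
  rcases h1 with h1 | ⟨h1, h1'⟩ <;> rcases h2 with h2 | ⟨h2, h2'⟩
  · exact .inl (h2.trans h1)
  · exact .inl (h2.trans_lt h1)
  · exact .inl (h2.trans_eq h1)
  · exact .inr ⟨h2.trans h1, h2'.trans h1'⟩⟩

/-- `sort(Y)` for a weak sentence `Y`, given as a finite list of words: the empty words are
removed and the remaining words are sorted. -/
def sort (Y : List (Word A)) : PSent A :=
  ⟨(Y.filter fun w => !w.isEmpty).insertionSort fun v w => gl w v,
    fun h => by
      rw [List.mem_insertionSort, List.mem_filter] at h
      simp at h,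
    List.pairwise_insertionSort _ _⟩

/-- The empty p-sentence. -/
def PSent.empty : PSent A := ⟨[], by simp, List.Pairwise.nil⟩

/-- `Q ⊑ P`: the words of `Q` form a submultiset of the words of `P`. -/
def PSent.Sub (Q P : PSent A) : Prop := (Q.words : Multiset (Word A)) ≤ (P.words : Multiset (Word A))

/-- The p-sentence that is left when the words of `Q` are removed, with multiplicity, from `P`. -/
def PSent.remove (P Q : PSent A) : PSent A :=
  ⟨P.words.diff Q.words, fun h => P.nil_notMem ((List.diff_sublist _ _).subset h),
    P.sorted.sublist (List.diff_sublist _ _)⟩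

/-- The pairs of weak sentences `Y = (y₁, …, yₘ)` and `Z = (z₁, …, zₘ)` with `sort(Y) = P`,
`sort(Z) = S` and `Q = (y₁z₁, …, yₘzₘ)`. -/
def concatPairs (P S Q : PSent A) : Set (List (Word A) × List (Word A)) :=
  {p | p.1.length = Q.words.length ∧ p.2.length = Q.words.length ∧
    sort p.1 = P ∧ sort p.2 = S ∧ List.zipWith (· ++ ·) p.1 p.2 = Q.words}

/-- The number `r^Q_{P,S}` of such pairs. -/
def r (P S Q : PSent A) : ℕ := (concatPairs P S Q).ncard

/-- The colored monomial symmetric function: the sum of the `M I` over the (finitely many)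
sentences `I` with `sort(I) = P`. -/
def m (P : PSent A) : QSymA A := ∑ᶠ (I : Sent A) (_ : sort I.words = P), M I

/-- The definition of `r` counts a finite set. -/
theorem finite_concatPairs (P S Q : PSent A) : (concatPairs P S Q).Finite := by
  have key : ∀ W : List (Word A), {p : List (Word A) × List (Word A) |
      p.1.length = W.length ∧ p.2.length = W.length ∧
        List.zipWith (· ++ ·) p.1 p.2 = W}.Finite := by
    intro W
    induction W with
    | nil =>
      refine (Set.finite_singleton (([], []) : List (Word A) × List (Word A))).subset ?_
      rintro ⟨Y, Z⟩ ⟨h1, h2, -⟩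
      simp only [List.length_nil, List.length_eq_zero_iff] at h1 h2
      simp [h1, h2]
    | cons w W ih =>
      refine (Set.Finite.image2 (fun (k : ℕ) (p : List (Word A) × List (Word A)) =>
        (w.take k :: p.1, w.drop k :: p.2)) (Set.finite_le_nat w.length) ih).subset ?_
      rintro ⟨Y, Z⟩ ⟨h1, h2, h3⟩
      rcases Y with _ | ⟨y, Y⟩
      · simp at h1
      rcases Z with _ | ⟨z, Z⟩
      · simp at h2
      simp only [List.zipWith_cons_cons, List.cons.injEq] at h3
      obtain ⟨rfl, h3⟩ := h3
      exact ⟨y.length, by simp, (Y, Z), ⟨by simpa using h1, by simpa using h2, h3⟩, by simp⟩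
  exact (key Q.words).subset fun p hp => ⟨hp.1, hp.2.1, hp.2.2.2.2⟩

/-- The sum that defines `m` is finite. -/
theorem finite_sort_eq (P : PSent A) : {I : Sent A | sort I.words = P}.Finite := by
  refine Set.Finite.subset ((P.words.permutations.finite_toSet).preimage
    (f := Sent.words) (fun I _ J _ h => Sent.ext h)) fun I hI => ?_
  have h1 : I.words.filter (fun w => !w.isEmpty) = I.words := by
    rw [List.filter_eq_self]
    intro w hw
    have : w ≠ [] := fun h => I.nil_notMem (h ▸ hw)
    simpa using this
  have h2 := List.perm_insertionSort (fun v w : Word A => gl w v)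
    (I.words.filter fun w => !w.isEmpty)
  rw [h1] at h2
  have h3 : (sort I.words).words = P.words := congrArg PSent.words hI
  simp only [sort, h1] at h3
  exact List.mem_permutations.2 (h3 ▸ h2.symm)

/-- There are finitely many `Q ⊑ P`. -/
theorem finite_sub (P : PSent A) : {Q : PSent A | Q.Sub P}.Finite := by
  refine Set.Finite.of_finite_image (f := fun Q : PSent A => (Q.words : Multiset (Word A)))
    ((Finset.finite_toSet (P.words : Multiset (Word A)).powerset.toFinset).subset ?_) ?_
  · rintro _ ⟨Q, hQ, rfl⟩
    have hQ' : (Q.words : Multiset (Word A)) ≤ P.words := hQ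
    exact Multiset.mem_toFinset.2 (Multiset.mem_powerset.2 hQ')
  · intro Q _ R _ h
    refine PSent.ext (List.Perm.eq_of_pairwise (le := fun v w : Word A => gl w v)
      (fun a b _ _ h1 h2 => ?_) Q.sorted R.sorted (Multiset.coe_eq_coe.1 h))
    unfold gl at h1 h2
    rcases h1 with h1 | ⟨h1, h1'⟩ <;> rcases h2 with h2 | ⟨h2, h2'⟩
    · omega
    · omega
    · omega
    · exact le_antisymm h2' h1'

end PSent

/-! ### Hopf algebras -/

section Hopf

variable {R H : Type*} [CommRing R] [Ring H] [Algebra R H]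

/-- The algebra `H` is a Hopf algebra with comultiplication `Δ`, counit `ε` and antipode `S`. -/
structure IsHopfAlgebra (Δ : H →ₗ[R] H ⊗[R] H) (ε : H →ₗ[R] R) (S : H →ₗ[R] H) : Prop where
  coassoc : TensorProduct.assoc R H H H ∘ₗ Δ.rTensor H ∘ₗ Δ = Δ.lTensor H ∘ₗ Δ
  rTensor_counit_comp_comul : ε.rTensor H ∘ₗ Δ = TensorProduct.mk R R H 1
  lTensor_counit_comp_comul : ε.lTensor H ∘ₗ Δ = (TensorProduct.mk R H R).flip 1
  counit_one : ε 1 = 1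
  counit_mul : ∀ x y, ε (x * y) = ε x * ε y
  comul_one : Δ 1 = 1
  comul_mul : ∀ x y, Δ (x * y) = Δ x * Δ y
  antipode_one : S 1 = 1
  antipode_mul : ∀ x y, S (x * y) = S y * S x
  mul_antipode_rTensor_comul :
    LinearMap.mul' R H ∘ₗ S.rTensor H ∘ₗ Δ = Algebra.linearMap R H ∘ₗ ε
  mul_antipode_lTensor_comul :
    LinearMap.mul' R H ∘ₗ S.lTensor H ∘ₗ Δ = Algebra.linearMap R H ∘ₗ ε

/-- The structure that Mathlib calls a Hopf algebra. -/
abbrev IsHopfAlgebra.toHopfAlgebra {Δ : H →ₗ[R] H ⊗[R] H} {ε : H →ₗ[R] R} {S : H →ₗ[R] H}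
    (h : IsHopfAlgebra Δ ε S) : HopfAlgebra R H where
  comul := Δ
  counit := ε
  antipode := S
  coassoc := h.coassoc
  rTensor_counit_comp_comul := h.rTensor_counit_comp_comul
  lTensor_counit_comp_comul := h.lTensor_counit_comp_comul
  counit_one := h.counit_one
  mul_compr₂_counit := by ext x y; exact h.counit_mul x y
  comul_one := h.comul_one
  mul_compr₂_comul := by ext x y; exact h.comul_mul x y
  mul_antipode_rTensor_comul := h.mul_antipode_rTensor_comul
  mul_antipode_lTensor_comul := h.mul_antipode_lTensor_comul

/-- The Hopf algebra `H` is graded by the submodules `𝒜 n`: it is their direct sum, the product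
maps `𝒜 i ⊗ 𝒜 j` to `𝒜 (i + j)`, and `Δ` maps `𝒜 n` to the sum of the `𝒜 i ⊗ 𝒜 j` with
`i + j = n`. -/
structure IsGradedHopfAlgebra (𝒜 : ℕ → Submodule R H) (Δ : H →ₗ[R] H ⊗[R] H) (ε : H →ₗ[R] R)
    (S : H →ₗ[R] H) : Prop extends IsHopfAlgebra Δ ε S where
  isInternal : DirectSum.IsInternal 𝒜
  gradedMonoid : SetLike.GradedMonoid 𝒜
  comul_mem : ∀ n, ∀ x ∈ 𝒜 n, Δ x ∈ ⨆ p ∈ Finset.HasAntidiagonal.antidiagonal n,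
    LinearMap.range (TensorProduct.map (𝒜 p.1).subtype (𝒜 p.2).subtype)

/-- A subalgebra `G` of the Hopf algebra `H` (with comultiplication `Δ`, counit `ε`, antipode `S`)
is a Hopf subalgebra, with the restricted maps `Δ'`, `ε'` and `S'`. -/
structure IsHopfSubalgebra (G : Subalgebra R H) (Δ : H →ₗ[R] H ⊗[R] H) (ε : H →ₗ[R] R)
    (S : H →ₗ[R] H) (Δ' : G →ₗ[R] G ⊗[R] G) (ε' : G →ₗ[R] R) (S' : G →ₗ[R] G) : Prop where
  comul_restrict : ∀ x : G, TensorProduct.map G.val.toLinearMap G.val.toLinearMap (Δ' x) = Δ x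
  counit_restrict : ∀ x : G, ε' x = ε x
  antipode_restrict : ∀ x : G, (S' x : H) = S x

end Hopf

end ColoredSym

end

/-! Everything is read off from coefficients. For a finite weak sentence `L`, the functional `coeff
L` takes the coefficient at the monomial of `L`; by quasisymmetry, empty words in `L` do not matter.
The coordinates of the basis `M` are among these functionals, so they separate `QSymA A`, and their
tensor products separate its tensor powers.

Two formulas carry the bialgebra structure. The product sums over wordwise factorizations of `L`
(`coeff_mul`), and the coproduct is dual to concatenation (`tensorFunctional_comulQ`).
Coassociativity and the counit laws become the monoid laws of `++`; the coproduct is multiplicative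
because a factorization of `L ++ L'` is a pair of factorizations. Recursion on the number of words
gives a left and a right convolution inverse of the identity; they coincide, and this is the
antipode.

Coefficients of a symmetric function are unchanged when words are reordered (`coeff_perm`), so those
at p-sentences determine it. As `m P` has coefficient 1 at `L` if `sort L = P` and 0 otherwise
(`coeff_m`), the `m P` are the dual basis. The product rule then counts factorizations, and the
coproduct rule is `sort_append_eq_iff`: `L ++ L'` sorts to `P` exactly when `L` sorts to some `Q ⊑
P` and `L'` to the rest. The antipode axiom at `m P` expresses the antipode of `m P` through those
of `m Q` with `Q` strictly below `P`, so the antipode preserves symmetry. The Hopf axioms descend to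
`SymA A` because its inclusion stays injective on tensor powers over a field. Each `m P` is
homogeneous, and the sizes of `Q` and `P.remove Q` add up to that of `P`, which gives the grading.
-/

open scoped TensorProduct

noncomputable section

namespace ColoredSym

/-! ### Antipodes from convolution inverses -/

section Hopf

variable {R H : Type*} [CommRing R] [Ring H] [Algebra R H]

/-- A bialgebra in which the identity has a left and a right convolution inverse is a Hopf
algebra. -/
theorem IsHopfAlgebra.of_convolution_inverses {Δ : H →ₗ[R] H ⊗[R] H} {ε : H →ₗ[R] R}
    {S S' : H →ₗ[R] H}
    (coassoc : TensorProduct.assoc R H H H ∘ₗ Δ.rTensor H ∘ₗ Δ = Δ.lTensor H ∘ₗ Δ)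
    (rTensor_counit : ε.rTensor H ∘ₗ Δ = TensorProduct.mk R R H 1)
    (lTensor_counit : ε.lTensor H ∘ₗ Δ = (TensorProduct.mk R H R).flip 1)
    (counit_one : ε 1 = 1) (counit_mul : ∀ x y, ε (x * y) = ε x * ε y)
    (comul_one : Δ 1 = 1) (comul_mul : ∀ x y, Δ (x * y) = Δ x * Δ y)
    (hS : LinearMap.mul' R H ∘ₗ S.rTensor H ∘ₗ Δ = Algebra.linearMap R H ∘ₗ ε)
    (hS' : LinearMap.mul' R H ∘ₗ S'.lTensor H ∘ₗ Δ = Algebra.linearMap R H ∘ₗ ε) :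
    IsHopfAlgebra Δ ε S := by
  let _ : Bialgebra R H :=
    { comul := Δ
      counit := ε
      coassoc := coassoc
      rTensor_counit_comp_comul := rTensor_counit
      lTensor_counit_comp_comul := lTensor_counit
      counit_one := counit_one
      mul_compr₂_counit := by ext x y; exact counit_mul x y
      comul_one := comul_one
      mul_compr₂_comul := by ext x y; exact comul_mul x y }
  -- The two hypotheses are, by definition, identities in the convolution monoid of endomorphisms,
  -- where a left and a right inverse of the same element agree.
  have h1 : WithConv.toConv S * WithConv.toConv (LinearMap.id : H →ₗ[R] H) = 1 :=
    congrArg WithConv.toConv hS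
  have h2 : WithConv.toConv (LinearMap.id : H →ₗ[R] H) * WithConv.toConv S' = 1 :=
    congrArg WithConv.toConv hS'
  have h3 : S = S' := WithConv.toConv_injective (left_inv_eq_right_inv h1 h2)
  let _ : HopfAlgebra R H :=
    { antipode := S
      mul_antipode_rTensor_comul := hS
      mul_antipode_lTensor_comul := h3 ▸ hS' }
  exact
    { coassoc := coassoc
      rTensor_counit_comp_comul := rTensor_counit
      lTensor_counit_comp_comul := lTensor_counit
      counit_one := counit_one
      counit_mul := counit_mul
      comul_one := comul_one
      comul_mul := comul_mul
      antipode_one := HopfAlgebra.antipode_one (R := R) (A := H)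
      antipode_mul := HopfAlgebra.antipode_mul_antidistrib (R := R) (A := H)
      mul_antipode_rTensor_comul := hS
      mul_antipode_lTensor_comul := h3 ▸ hS' }

end Hopf

/-! ### Restricting Hopf algebra axioms to a subalgebra -/

section Restrict

variable {F H : Type*} [CommRing F] [Ring H] [Algebra F H]

/-- A flat subalgebra of a flat Hopf algebra to which all the structure maps restrict is a Hopf
algebra. -/
theorem IsHopfSubalgebra.isHopfAlgebra {G : Subalgebra F H}
    [Module.Flat F G] [Module.Flat F H] {Δ : H →ₗ[F] H ⊗[F] H}
    {ε : H →ₗ[F] F} {S : H →ₗ[F] H} {Δ' : G →ₗ[F] G ⊗[F] G} {ε' : G →ₗ[F] F} {S' : G →ₗ[F] G}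
    (h : IsHopfSubalgebra G Δ ε S Δ' ε' S') (hH : IsHopfAlgebra Δ ε S) :
    IsHopfAlgebra Δ' ε' S' := by
  set ι : G →ₗ[F] H := G.val.toLinearMap with hι
  have inj : Function.Injective ι := Subtype.val_injective
  -- Flatness keeps the inclusion injective on the double and triple tensor powers, so each axiom
  -- may be checked after mapping into `H`, where naturality turns it into the axiom of `H`.
  have inj2 : Function.Injective (TensorProduct.map ι ι) :=
    TensorProduct.map_injective_of_flat_flat _ _ inj inj
  have inj3 : Function.Injective (TensorProduct.map ι (TensorProduct.map ι ι)) :=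
    TensorProduct.map_injective_of_flat_flat _ _ inj inj2
  have hΔ : TensorProduct.map ι ι ∘ₗ Δ' = Δ ∘ₗ ι := LinearMap.ext h.comul_restrict
  have hε : ε' = ε ∘ₗ ι := LinearMap.ext h.counit_restrict
  have hS : ι ∘ₗ S' = S ∘ₗ ι := LinearMap.ext h.antipode_restrict
  have hmul2 : ∀ x y, TensorProduct.map ι ι (x * y) =
      TensorProduct.map ι ι x * TensorProduct.map ι ι y :=
    fun x y => map_mul (Algebra.TensorProduct.map G.val G.val) x y
  have hmul : ι ∘ₗ LinearMap.mul' F G = LinearMap.mul' F H ∘ₗ TensorProduct.map ι ι := by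
    ext x y; rfl
  constructor
  · refine LinearMap.ext fun x => inj3 ?_
    have e1 : TensorProduct.map ι (TensorProduct.map ι ι) ∘ₗ
        (TensorProduct.assoc F G G G).toLinearMap ∘ₗ Δ'.rTensor G =
        (TensorProduct.assoc F H H H).toLinearMap ∘ₗ Δ.rTensor H ∘ₗ TensorProduct.map ι ι := by
      have : (TensorProduct.map ι (TensorProduct.map ι ι)) ∘ₗ
          (TensorProduct.assoc F G G G).toLinearMap =
          (TensorProduct.assoc F H H H).toLinearMap ∘ₗ
            TensorProduct.map (TensorProduct.map ι ι) ι := by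
        ext; rfl
      rw [← LinearMap.comp_assoc, this, LinearMap.comp_assoc, LinearMap.map_comp_rTensor, hΔ,
        LinearMap.rTensor_comp_map]
    have e2 : TensorProduct.map ι (TensorProduct.map ι ι) ∘ₗ Δ'.lTensor G =
        Δ.lTensor H ∘ₗ TensorProduct.map ι ι := by
      rw [LinearMap.map_comp_lTensor, hΔ, LinearMap.lTensor_comp_map]
    calc _ = _ := LinearMap.congr_fun e1 (Δ' x)
      _ = (TensorProduct.assoc F H H H ∘ₗ Δ.rTensor H ∘ₗ Δ) (ι x) := by
        rw [LinearMap.comp_apply, LinearMap.comp_apply, ← LinearMap.comp_apply _ Δ', hΔ]; rfl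
      _ = (Δ.lTensor H ∘ₗ Δ) (ι x) := by rw [hH.coassoc]
      _ = (Δ.lTensor H ∘ₗ TensorProduct.map ι ι) (Δ' x) := by
        rw [LinearMap.comp_apply, LinearMap.comp_apply, ← LinearMap.comp_apply _ Δ', hΔ]; rfl
      _ = _ := (LinearMap.congr_fun e2 (Δ' x)).symm
  · have : Function.Injective (ι.lTensor F) := Module.Flat.lTensor_preserves_injective_linearMap ι inj
    refine LinearMap.ext fun x => this ?_
    have e : ι.lTensor F ∘ₗ ε'.rTensor G = ε.rTensor H ∘ₗ TensorProduct.map ι ι := by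
      rw [hε]; ext; rfl
    calc _ = _ := LinearMap.congr_fun e (Δ' x)
      _ = (ε.rTensor H ∘ₗ Δ) (ι x) := by
        rw [LinearMap.comp_apply, ← LinearMap.comp_apply _ Δ', hΔ]; rfl
      _ = _ := by rw [hH.rTensor_counit_comp_comul]; rfl
  · have : Function.Injective (ι.rTensor F) := Module.Flat.rTensor_preserves_injective_linearMap ι inj
    refine LinearMap.ext fun x => this ?_
    have e : ι.rTensor F ∘ₗ ε'.lTensor G = ε.lTensor H ∘ₗ TensorProduct.map ι ι := by
      rw [hε]; ext; rfl
    calc _ = _ := LinearMap.congr_fun e (Δ' x)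
      _ = (ε.lTensor H ∘ₗ Δ) (ι x) := by
        rw [LinearMap.comp_apply, ← LinearMap.comp_apply _ Δ', hΔ]; rfl
      _ = _ := by rw [hH.lTensor_counit_comp_comul]; rfl
  · rw [h.counit_restrict]; exact hH.counit_one
  · intro x y
    simp only [h.counit_restrict]
    exact hH.counit_mul _ _
  · apply inj2
    rw [h.comul_restrict]
    exact hH.comul_one.trans (map_one (Algebra.TensorProduct.map G.val G.val)).symm
  · intro x y
    apply inj2
    rw [hmul2, h.comul_restrict, h.comul_restrict, h.comul_restrict]
    exact hH.comul_mul _ _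
  · apply inj
    exact (h.antipode_restrict 1).trans hH.antipode_one
  · intro x y
    apply inj
    refine (h.antipode_restrict _).trans ((hH.antipode_mul _ _).trans ?_)
    rw [← h.antipode_restrict, ← h.antipode_restrict]
    rfl
  · refine LinearMap.ext fun x => inj ?_
    have e : ι ∘ₗ LinearMap.mul' F G ∘ₗ S'.rTensor G =
        LinearMap.mul' F H ∘ₗ S.rTensor H ∘ₗ TensorProduct.map ι ι := by
      rw [← LinearMap.comp_assoc, hmul, LinearMap.comp_assoc, LinearMap.map_comp_rTensor, hS,
        LinearMap.rTensor_comp_map]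
    calc _ = _ := LinearMap.congr_fun e (Δ' x)
      _ = (LinearMap.mul' F H ∘ₗ S.rTensor H ∘ₗ Δ) (ι x) := by
        rw [LinearMap.comp_apply, LinearMap.comp_apply, ← LinearMap.comp_apply _ Δ', hΔ]; rfl
      _ = _ := by rw [hH.mul_antipode_rTensor_comul, hε]; rfl
  · refine LinearMap.ext fun x => inj ?_
    have e : ι ∘ₗ LinearMap.mul' F G ∘ₗ S'.lTensor G =
        LinearMap.mul' F H ∘ₗ S.lTensor H ∘ₗ TensorProduct.map ι ι := by
      rw [← LinearMap.comp_assoc, hmul, LinearMap.comp_assoc, LinearMap.map_comp_lTensor, hS,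
        LinearMap.lTensor_comp_map]
    calc _ = _ := LinearMap.congr_fun e (Δ' x)
      _ = (LinearMap.mul' F H ∘ₗ S.lTensor H ∘ₗ Δ) (ι x) := by
        rw [LinearMap.comp_apply, LinearMap.comp_apply, ← LinearMap.comp_apply _ Δ', hΔ]; rfl
      _ = _ := by rw [hH.mul_antipode_lTensor_comul, hε]; rfl

end Restrict


section

/-! ### Separating tensors by products of functionals -/

section TensorCoordinates

variable {R V W : Type*} [CommRing R] [AddCommGroup V] [Module R V] [AddCommGroup W] [Module R W]

/-- The product of two linear functionals, as a functional on the tensor product. -/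
def tensorFunctional (φ : V →ₗ[R] R) (ψ : W →ₗ[R] R) : V ⊗[R] W →ₗ[R] R :=
  LinearMap.mul' R R ∘ₗ TensorProduct.map φ ψ

@[simp]
theorem tensorFunctional_tmul (φ : V →ₗ[R] R) (ψ : W →ₗ[R] R) (v : V) (w : W) :
    tensorFunctional φ ψ (v ⊗ₜ w) = φ v * ψ w := rfl

theorem coord_tensorProduct {ι κ : Type*} (b : Module.Basis ι R V) (c : Module.Basis κ R W)
    (i : ι) (j : κ) :
    (b.tensorProduct c).coord (i, j) = tensorFunctional (b.coord i) (c.coord j) := by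
  ext v w
  simp [Module.Basis.tensorProduct_repr_tmul_apply, mul_comm]

theorem tensor_ext {ι κ : Type*} (b : Module.Basis ι R V) (c : Module.Basis κ R W)
    {x y : V ⊗[R] W}
    (h : ∀ i j, tensorFunctional (b.coord i) (c.coord j) x =
      tensorFunctional (b.coord i) (c.coord j) y) : x = y := by
  refine (b.tensorProduct c).ext_elem fun ⟨i, j⟩ => ?_
  have := h i j
  rwa [← coord_tensorProduct] at this

end TensorCoordinates

/-! ### Coefficients along finite weak sentences -/

variable {A : Type*}

/-- The finite weak sentence `L`, continued by empty words. -/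
def WSent.ofList (L : List (Word A)) : WSent A :=
  ⟨fun i => L.getD i [], (Set.finite_lt_nat L.length).subset fun i hi => by
    by_contra h
    exact hi (by simp only [Set.mem_ofPred_eq, not_lt] at h; simp [h])⟩

theorem WSent.ofList_word (L : List (Word A)) (i : ℕ) : (ofList L).word i = L.getD i [] := rfl

theorem WSent.flatten_ofList (L : List (Word A)) :
    (ofList L).flatten.words = L.filter (fun w => !w.isEmpty) := by
  rw [WSent.flatten_words_eq _ (List.range L.length) List.pairwise_lt_range]
  · congr 1
    apply List.ext_getElem
    · simp
    · intro i h1 h2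
      simp [ofList_word, h2]
  · intro i hi
    rw [List.mem_range]
    by_contra h
    exact hi (by simp [ofList_word, not_lt.1 h])

theorem WSent.ofList_map_range (K : WSent A) (n : ℕ) (h : ∀ i, K.word i ≠ [] → i < n) :
    ofList ((List.range n).map K.word) = K := by
  refine WSent.ext (funext fun i => ?_)
  rw [ofList_word]
  by_cases hi : i < n
  · simp [hi]
  · have h0 : K.word i = [] := by
      by_contra h1
      exact hi (h i h1)
    simp [hi, h0]

theorem Sent.filter_words (I : Sent A) : I.words.filter (fun w => !w.isEmpty) = I.words := by
  rw [List.filter_eq_self]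
  intro w hw
  have : w ≠ [] := fun h => I.nil_notMem (h ▸ hw)
  simpa using this

/-- The coefficient of a colored quasisymmetric function at a finite weak sentence. -/
def coeff (L : List (Word A)) : QSymA A →ₗ[ℚ] ℚ where
  toFun f := f.1 (.ofList L)
  map_add' _ _ := rfl
  map_smul' _ _ := rfl

theorem coeff_apply (L : List (Word A)) (f : QSymA A) : coeff L f = f.1 (.ofList L) := rfl

/-- This is quasisymmetry: both weak sentences flatten to the same sentence. -/
theorem coeff_congr {L L' : List (Word A)}
    (h : L.filter (fun w => !w.isEmpty) = L'.filter (fun w => !w.isEmpty)) (f : QSymA A) :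
    coeff L f = coeff L' f :=
  f.2.2 _ _ (Sent.ext (by rw [WSent.flatten_ofList, WSent.flatten_ofList, h]))

theorem coeff_flatten (K : WSent A) (f : QSymA A) : coeff K.flatten.words f = f.1 K :=
  f.2.2.apply_toWSent K

theorem qsym_ext {f g : QSymA A} (h : ∀ L, coeff L f = coeff L g) : f = g :=
  Subtype.ext (funext fun K => by rw [← coeff_flatten, ← coeff_flatten, h])

open Classical in
theorem coeff_M (L : List (Word A)) (I : Sent A) :
    coeff L (M I) = if L.filter (fun w => !w.isEmpty) = I.words then 1 else 0 := by
  change (if (WSent.ofList L).flatten = I then (1 : ℚ) else 0) = _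
  simp only [Sent.ext_iff, WSent.flatten_ofList]

open Classical in
theorem coeff_one (L : List (Word A)) :
    coeff L 1 = if L.filter (fun w => !w.isEmpty) = [] then 1 else 0 := by
  change (1 : Series A) (WSent.ofList L) = _
  rw [Series.one_apply, ← WSent.flatten_ofList]
  refine if_congr ⟨fun h => ?_, WSent.flatten_eq_nil⟩ rfl rfl
  rw [h, WSent.flatten_one]

theorem M_nil : M (⟨[], by simp⟩ : Sent A) = 1 :=
  qsym_ext fun L => by rw [coeff_M, coeff_one]

/-- Turns the counit laws into the case of an empty list in the concatenation formula for the
coproduct. -/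
theorem counitQ_eq_coeff : counitQ A = coeff [] := by
  refine LinearMap.ext fun f => congrArg f.1 (WSent.ext (funext fun i => ?_))
  simp [WSent.ofList_word, WSent.one_apply]

theorem coord_basisM [Finite A] (I : Sent A) : (basisM A).coord I = coeff I.words := rfl

/-- Elements of the tensor square are determined by their coefficients. -/
theorem qsym_tensor_ext [Finite A] {x y : QSymA A ⊗[ℚ] QSymA A}
    (h : ∀ L L', tensorFunctional (coeff L) (coeff L') x =
      tensorFunctional (coeff L) (coeff L') y) : x = y :=
  tensor_ext (basisM A) (basisM A) fun _ _ => h _ _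

/-! ### Coefficients of products -/

open Classical in
/-- The factorizations of a finite weak sentence into two weak sentences of the same length. -/
def listFactor (L : List (Word A)) : Finset (List (Word A) × List (Word A)) :=
  (factor (WSent.ofList L)).image fun p =>
    ((List.range L.length).map p.1.word, (List.range L.length).map p.2.word)

/-- Beyond `L` the product has empty words, hence so do both factors. Truncating the factors to the
length of `L` therefore loses nothing. -/
theorem lt_length_of_mem_factor {L : List (Word A)} {p : WSent A × WSent A}
    (hp : p ∈ factor (WSent.ofList L)) :
    (∀ i, p.1.word i ≠ [] → i < L.length) ∧ (∀ i, p.2.word i ≠ [] → i < L.length) := by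
  rw [mem_factor] at hp
  have key : ∀ i, ¬ i < L.length → p.1.word i = [] ∧ p.2.word i = [] := fun i hi => by
    rw [← List.append_eq_nil_iff, ← WSent.mul_apply, hp, WSent.ofList_word]
    exact List.getD_eq_default _ _ (not_lt.1 hi)
  constructor <;> intro i hi <;> by_contra h
  · exact hi (key i h).1
  · exact hi (key i h).2

theorem mem_listFactor {L : List (Word A)} {p : List (Word A) × List (Word A)} :
    p ∈ listFactor L ↔ p.1.length = L.length ∧ p.2.length = L.length ∧
      List.zipWith (· ++ ·) p.1 p.2 = L := by
  classical
  rw [listFactor, Finset.mem_image]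
  constructor
  · rintro ⟨⟨Y, Z⟩, hp, rfl⟩
    rw [mem_factor] at hp
    refine ⟨by simp, by simp, List.ext_getElem (by simp) fun i h1 h2 => ?_⟩
    have := congrArg (fun K : WSent A => K.word i) hp
    simp only [WSent.mul_apply, WSent.ofList_word, List.getD_eq_getElem _ _ h2] at this
    simpa using this
  · rintro ⟨h1, h2, h3⟩
    refine ⟨(.ofList p.1, .ofList p.2), ?_, Prod.ext ?_ ?_⟩
    · rw [mem_factor]
      refine WSent.ext (funext fun i => ?_)
      simp only [WSent.mul_apply, WSent.ofList_word]
      by_cases hi : i < L.length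
      · rw [List.getD_eq_getElem _ _ (h1 ▸ hi), List.getD_eq_getElem _ _ (h2 ▸ hi),
          List.getD_eq_getElem _ _ hi]
        simp [← h3]
      · rw [List.getD_eq_default _ _ (by omega), List.getD_eq_default _ _ (by omega),
          List.getD_eq_default _ _ (by omega), List.append_nil]
    · refine List.ext_getElem (by simp [h1]) fun i h4 h5 => ?_
      simp [WSent.ofList_word, h5]
    · refine List.ext_getElem (by simp [h2]) fun i h4 h5 => ?_
      simp [WSent.ofList_word, h5]

/-- Truncation to the length of `L` is injective on factorizations and preserves the factors'
coefficients, so the sum defining the product can be taken over lists. -/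
theorem coeff_mul (L : List (Word A)) (f g : QSymA A) :
    coeff L (f * g) = ∑ p ∈ listFactor L, coeff p.1 f * coeff p.2 g := by
  classical
  have key : ∀ p ∈ factor (WSent.ofList L),
      WSent.ofList ((List.range L.length).map p.1.word) = p.1 ∧
        WSent.ofList ((List.range L.length).map p.2.word) = p.2 := fun p hp =>
    ⟨WSent.ofList_map_range _ _ (lt_length_of_mem_factor hp).1,
      WSent.ofList_map_range _ _ (lt_length_of_mem_factor hp).2⟩
  rw [listFactor, Finset.sum_image]
  · change ∑ p ∈ factor (WSent.ofList L), f.1 p.1 * g.1 p.2 = _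
    refine Finset.sum_congr rfl fun p hp => ?_
    rw [coeff_apply, coeff_apply, (key p hp).1, (key p hp).2]
  · intro p hp q hq h
    rw [Prod.ext_iff] at h
    refine Prod.ext ?_ ?_
    · rw [← (key p hp).1, ← (key q hq).1]
      exact congrArg _ h.1
    · rw [← (key p hp).2, ← (key q hq).2]
      exact congrArg _ h.2

/-- Factoring acts word by word, so cutting both factors after `L.length` words splits a
factorization of `L ++ L'` into one of `L` and one of `L'`. This is what makes the coproduct
multiplicative. -/
theorem sum_listFactor_append {E : Type*} [AddCommMonoid E] (L L' : List (Word A))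
    (F : List (Word A) → List (Word A) → E) :
    ∑ p ∈ listFactor (L ++ L'), F p.1 p.2 =
      ∑ p ∈ listFactor L, ∑ q ∈ listFactor L', F (p.1 ++ q.1) (p.2 ++ q.2) := by
  rw [← Finset.sum_product']
  refine Finset.sum_bij'
    (fun p _ => ((p.1.take L.length, p.2.take L.length), (p.1.drop L.length, p.2.drop L.length)))
    (fun p _ => (p.1.1 ++ p.2.1, p.1.2 ++ p.2.2)) ?_ ?_ ?_ ?_ ?_
  · intro p hp
    simp only [mem_listFactor, Finset.mem_product, List.length_append] at hp ⊢
    obtain ⟨h1, h2, h3⟩ := hp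
    refine ⟨⟨by simp [h1], by simp [h2], ?_⟩, by simp [h1], by simp [h2], ?_⟩
    · rw [← List.take_zipWith, h3, List.take_left]
    · rw [← List.drop_zipWith, h3, List.drop_left]
  · intro p hp
    simp only [mem_listFactor, Finset.mem_product, List.length_append] at hp ⊢
    obtain ⟨⟨h1, h2, h3⟩, h4, h5, h6⟩ := hp
    refine ⟨by rw [h1, h4], by rw [h2, h5], ?_⟩
    rw [List.zipWith_append (by rw [h1, h2]), h3, h6]
  · intro p _
    simp
  · intro p hp
    simp only [mem_listFactor, Finset.mem_product] at hp
    obtain ⟨⟨h1, h2, -⟩, -⟩ := hp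
    refine Prod.ext (Prod.ext ?_ ?_) (Prod.ext ?_ ?_)
    · exact List.take_left' h1
    · exact List.take_left' h2
    · exact List.drop_left' h1
    · exact List.drop_left' h2
  · intro p _
    simp

theorem tensorFunctional_mul (L L' : List (Word A)) (x y : QSymA A ⊗[ℚ] QSymA A) :
    tensorFunctional (coeff L) (coeff L') (x * y) =
      ∑ p ∈ listFactor L, ∑ q ∈ listFactor L',
        tensorFunctional (coeff p.1) (coeff q.1) x *
          tensorFunctional (coeff p.2) (coeff q.2) y := by
  induction x with
  | zero => simp
  | add x₁ x₂ h₁ h₂ => simp only [add_mul, map_add, h₁, h₂, Finset.sum_add_distrib]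
  | tmul a b =>
    induction y with
    | zero => simp
    | add y₁ y₂ h₁ h₂ => simp only [mul_add, map_add, h₁, h₂, Finset.sum_add_distrib]
    | tmul c d =>
      rw [Algebra.TensorProduct.tmul_mul_tmul, tensorFunctional_tmul, coeff_mul, coeff_mul,
        Finset.sum_mul_sum]
      refine Finset.sum_congr rfl fun p _ => Finset.sum_congr rfl fun q _ => ?_
      simp only [tensorFunctional_tmul]
      ring

theorem counitQ_one : counitQ A 1 = 1 := by
  rw [counitQ_eq_coeff, coeff_one]
  simp

theorem counitQ_mul (f g : QSymA A) : counitQ A (f * g) = counitQ A f * counitQ A g := by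
  have h : listFactor ([] : List (Word A)) = {([], [])} := by
    ext p
    simp only [mem_listFactor, List.length_nil, List.length_eq_zero_iff, Finset.mem_singleton,
      Prod.ext_iff]
    constructor
    · exact fun h => ⟨h.1, h.2.1⟩
    · exact fun h => ⟨h.1, h.2, by rw [h.1]; rfl⟩
  rw [counitQ_eq_coeff, coeff_mul, h, Finset.sum_singleton]

theorem counitQ_M (I : Sent A) (hI : I.words ≠ []) : counitQ A (M I) = 0 := by
  rw [counitQ_eq_coeff, coeff_M, if_neg]
  exact fun h => hI h.symm

theorem Sent.take_length (I : Sent A) : I.take I.words.length = I :=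
  Sent.ext (List.take_length)

theorem M_eq_one {I : Sent A} (h : I.words = []) : M I = 1 := by
  rw [← M_nil]
  exact congrArg M (Sent.ext h)

/-! ### The antipode on the monomial basis -/

/-- The left convolution inverse of the identity, on the basis. -/
def antipodeM (I : Sent A) : QSymA A :=
  if I.words = [] then 1 else
    -- The antipode identity at `M I` solved for its last summand: the cut after all words
    -- contributes `antipodeM I * 1`.
    -∑ k : Fin I.words.length, antipodeM (I.take k) * M (I.drop k)
termination_by I.words.length
decreasing_by simp [Sent.take]

/-- The right convolution inverse of the identity, on the basis. -/
def rightAntipodeM (I : Sent A) : QSymA A :=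
  if I.words = [] then 1 else
    -- Here the unknown is the cut before the first word, so the remaining cuts are those at `k +
    -- 1`.
    -∑ k : Fin I.words.length, M (I.take (k + 1)) * rightAntipodeM (I.drop (k + 1))
termination_by I.words.length
decreasing_by have := k.2; simp only [Sent.drop, List.length_drop]; omega

theorem antipodeM_nil {I : Sent A} (h : I.words = []) : antipodeM I = 1 := by
  rw [antipodeM, if_pos h]

theorem rightAntipodeM_nil {I : Sent A} (h : I.words = []) : rightAntipodeM I = 1 := by
  rw [rightAntipodeM, if_pos h]

/-! ### The bialgebra of colored quasisymmetric functions -/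

variable [Finite A]

theorem comulQ_M (I : Sent A) : comulQ A (M I) =
    ∑ k ∈ Finset.range (I.words.length + 1), M (I.take k) ⊗ₜ[ℚ] M (I.drop k) := by
  rw [← basisM_apply, comulQ, Module.Basis.constr_basis]

/-- The coproduct is dual to concatenation: a nonempty contribution to the left side is a cut of `I`
into the nonempty words of `L` and those of `L'`. -/
theorem tensorFunctional_comulQ (L L' : List (Word A)) (f : QSymA A) :
    tensorFunctional (coeff L) (coeff L') (comulQ A f) = coeff (L ++ L') f := by
  classical
  suffices h : tensorFunctional (coeff L) (coeff L') ∘ₗ comulQ A = coeff (L ++ L') from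
    LinearMap.congr_fun h f
  refine (basisM A).ext fun I => ?_
  rw [basisM_apply, LinearMap.comp_apply, comulQ_M, map_sum, coeff_M, List.filter_append]
  simp only [tensorFunctional_tmul, coeff_M, Sent.take, Sent.drop]
  set U := L.filter (fun w => !w.isEmpty)
  set V := L'.filter (fun w => !w.isEmpty)
  -- The first `k` words of `I` can equal `U` only for `k = U.length`, so at most one cut
  -- contributes; if `U` has more words than `I`, none does.
  rw [Finset.sum_eq_single U.length]
  · by_cases h : U ++ V = I.words
    · simp [← h]
    · rw [if_neg h]
      by_cases h1 : U = I.words.take U.length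
      · rw [if_neg (c := V = _), mul_zero]
        exact fun h2 => h ((congrArg₂ _ h1 h2).trans (List.take_append_drop _ _))
      · rw [if_neg h1, zero_mul]
  · intro k hk hne
    rw [if_neg, zero_mul]
    intro h
    apply hne
    rw [h, List.length_take]
    have := Finset.mem_range.1 hk
    omega
  · intro h
    rw [if_neg, zero_mul]
    intro h1
    apply h
    have := congrArg List.length h1
    rw [List.length_take] at this
    rw [Finset.mem_range]
    omega

/-- Tested against three coefficient functionals, the sides give the coefficients at `(L ++ L') ++
L''` and `L ++ (L' ++ L'')`. -/
theorem comulQ_coassoc : TensorProduct.assoc ℚ (QSymA A) (QSymA A) (QSymA A) ∘ₗ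
    (comulQ A).rTensor (QSymA A) ∘ₗ comulQ A = (comulQ A).lTensor (QSymA A) ∘ₗ comulQ A := by
  refine LinearMap.ext fun f => tensor_ext (basisM A) ((basisM A).tensorProduct (basisM A)) ?_
  rintro I ⟨J, K⟩
  rw [coord_tensorProduct, coord_basisM, coord_basisM, coord_basisM]
  generalize I.words = L, J.words = L', K.words = L''
  have hcomul : ∀ L L' : List (Word A),
      tensorFunctional (coeff L) (coeff L') ∘ₗ comulQ A = coeff (L ++ L') :=
    fun L L' => LinearMap.ext (tensorFunctional_comulQ L L')
  have e1 : tensorFunctional (coeff L) (tensorFunctional (coeff L') (coeff L'')) ∘ₗ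
      (TensorProduct.assoc ℚ (QSymA A) (QSymA A) (QSymA A)).toLinearMap ∘ₗ
        (comulQ A).rTensor (QSymA A) = tensorFunctional (coeff (L ++ L')) (coeff L'') := by
    have : tensorFunctional (coeff L) (tensorFunctional (coeff L') (coeff L'')) ∘ₗ
        (TensorProduct.assoc ℚ (QSymA A) (QSymA A) (QSymA A)).toLinearMap =
        tensorFunctional (tensorFunctional (coeff L) (coeff L')) (coeff L'') := by
      ext f g h
      exact (mul_assoc _ _ _).symm
    rw [← LinearMap.comp_assoc, this, tensorFunctional, LinearMap.comp_assoc,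
      LinearMap.map_comp_rTensor, hcomul]
    rfl
  have e2 : tensorFunctional (coeff L) (tensorFunctional (coeff L') (coeff L'')) ∘ₗ
      (comulQ A).lTensor (QSymA A) = tensorFunctional (coeff L) (coeff (L' ++ L'')) := by
    rw [tensorFunctional, LinearMap.comp_assoc, LinearMap.map_comp_lTensor, hcomul]
    rfl
  calc _ = _ := LinearMap.congr_fun e1 (comulQ A f)
    _ = _ := by rw [tensorFunctional_comulQ, List.append_assoc, ← tensorFunctional_comulQ]
    _ = _ := (LinearMap.congr_fun e2 (comulQ A f)).symm

theorem rTensor_counitQ_comulQ :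
    (counitQ A).rTensor (QSymA A) ∘ₗ comulQ A = TensorProduct.mk ℚ ℚ (QSymA A) 1 := by
  refine LinearMap.ext fun f => (TensorProduct.lid ℚ (QSymA A)).injective (qsym_ext fun L => ?_)
  have e : coeff L ∘ₗ (TensorProduct.lid ℚ (QSymA A)).toLinearMap ∘ₗ
      (counitQ A).rTensor (QSymA A) = tensorFunctional (coeff []) (coeff L) := by
    rw [counitQ_eq_coeff]
    ext f g
    simp
  refine (LinearMap.congr_fun e (comulQ A f)).trans ?_
  rw [tensorFunctional_comulQ]
  simp

theorem lTensor_counitQ_comulQ :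
    (counitQ A).lTensor (QSymA A) ∘ₗ comulQ A = (TensorProduct.mk ℚ (QSymA A) ℚ).flip 1 := by
  refine LinearMap.ext fun f => (TensorProduct.rid ℚ (QSymA A)).injective (qsym_ext fun L => ?_)
  have e : coeff L ∘ₗ (TensorProduct.rid ℚ (QSymA A)).toLinearMap ∘ₗ
      (counitQ A).lTensor (QSymA A) = tensorFunctional (coeff L) (coeff []) := by
    rw [counitQ_eq_coeff]
    ext f g
    simp [mul_comm]
  refine (LinearMap.congr_fun e (comulQ A f)).trans ?_
  rw [tensorFunctional_comulQ]
  simp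

theorem comulQ_one : comulQ A 1 = 1 := by
  classical
  refine qsym_tensor_ext fun L L' => ?_
  rw [tensorFunctional_comulQ, Algebra.TensorProduct.one_def, tensorFunctional_tmul]
  simp only [coeff_one, List.filter_append, List.append_eq_nil_iff, ite_and]
  split_ifs <;> simp

theorem comulQ_mul (f g : QSymA A) : comulQ A (f * g) = comulQ A f * comulQ A g := by
  refine qsym_tensor_ext fun L L' => ?_
  rw [tensorFunctional_comulQ, tensorFunctional_mul, coeff_mul,
    sum_listFactor_append L L' fun Y Z => coeff Y f * coeff Z g]
  simp only [tensorFunctional_comulQ]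

/-! ### The antipode -/

/-- The antipode of the colored quasisymmetric functions. -/
def antipodeQ (A : Type*) [Finite A] : QSymA A →ₗ[ℚ] QSymA A :=
  (basisM A).constr ℚ antipodeM

theorem antipodeQ_M (I : Sent A) : antipodeQ A (M I) = antipodeM I := by
  rw [← basisM_apply, antipodeQ, Module.Basis.constr_basis]

theorem mul_antipodeQ_rTensor_comulQ :
    LinearMap.mul' ℚ (QSymA A) ∘ₗ (antipodeQ A).rTensor (QSymA A) ∘ₗ comulQ A =
      Algebra.linearMap ℚ (QSymA A) ∘ₗ counitQ A := by
  refine (basisM A).ext fun I => ?_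
  simp only [basisM_apply, LinearMap.comp_apply, comulQ_M, map_sum, LinearMap.rTensor_tmul,
    LinearMap.mul'_apply, antipodeQ_M]
  by_cases hI : I.words = []
  · rw [hI, List.length_nil, Finset.sum_range_one, antipodeM_nil (by simp [Sent.take, hI]),
      M_eq_one (by simp [Sent.drop, hI]), M_eq_one hI, counitQ_one]
    simp
  · rw [Finset.sum_range_succ, Finset.sum_range fun k => antipodeM (I.take k) * M (I.drop k),
      Sent.take_length, M_eq_one (by simp [Sent.drop]), mul_one, counitQ_M I hI, map_zero,
      antipodeM, if_neg hI, add_neg_cancel]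

theorem exists_right_antipodeQ : ∃ S : QSymA A →ₗ[ℚ] QSymA A,
    LinearMap.mul' ℚ (QSymA A) ∘ₗ S.lTensor (QSymA A) ∘ₗ comulQ A =
      Algebra.linearMap ℚ (QSymA A) ∘ₗ counitQ A := by
  refine ⟨(basisM A).constr ℚ rightAntipodeM, (basisM A).ext fun I => ?_⟩
  have hS : ∀ J : Sent A, (basisM A).constr ℚ rightAntipodeM (M J) = rightAntipodeM J := fun J => by
    rw [← basisM_apply, Module.Basis.constr_basis]
  simp only [basisM_apply, LinearMap.comp_apply, comulQ_M, map_sum, LinearMap.lTensor_tmul,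
    LinearMap.mul'_apply, hS]
  by_cases hI : I.words = []
  · rw [hI, List.length_nil, Finset.sum_range_one, rightAntipodeM_nil (by simp [Sent.drop, hI]),
      M_eq_one (by simp [Sent.take, hI]), M_eq_one hI, counitQ_one]
    simp
  · rw [Finset.sum_range_succ',
      Finset.sum_range fun k => M (I.take (k + 1)) * rightAntipodeM (I.drop (k + 1)),
      show I.drop 0 = I from rfl, M_eq_one (by simp [Sent.take]), one_mul, counitQ_M I hI,
      map_zero, rightAntipodeM, if_neg hI, add_neg_cancel]

theorem isHopfAlgebra_qsym : IsHopfAlgebra (comulQ A) (counitQ A) (antipodeQ A) :=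
  exists_right_antipodeQ.elim fun _ hS =>
    .of_convolution_inverses comulQ_coassoc rTensor_counitQ_comulQ lTensor_counitQ_comulQ
      counitQ_one counitQ_mul comulQ_one comulQ_mul mul_antipodeQ_rTensor_comulQ hS

end

section

variable {A : Type*}

/-! ### Symmetry in terms of coefficients -/

/-- Symmetry is applied to the transposition of the two adjacent indices that carry `v` and `w`. -/
theorem coeff_append_swap {f : QSymA A} (hf : f ∈ SymA A) (U L : List (Word A)) (v w : Word A) :
    coeff (U ++ v :: w :: L) f = coeff (U ++ w :: v :: L) f := by
  refine hf (Equiv.swap U.length (U.length + 1)) _ _ fun i => ?_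
  rw [WSent.ofList_word, WSent.ofList_word]
  rcases lt_or_ge i U.length with h | h
  · rw [Equiv.swap_apply_of_ne_of_ne (by omega) (by omega), List.getD_append _ _ _ _ h,
      List.getD_append _ _ _ _ h]
  · obtain ⟨j, rfl⟩ := Nat.exists_eq_add_of_le h
    match j with
    | 0 => simp
    | 1 => simp
    | j + 2 =>
      rw [Equiv.swap_apply_of_ne_of_ne (by omega) (by omega)]
      simp [List.getElem?_append_right]

theorem coeff_perm {f : QSymA A} (hf : f ∈ SymA A) {L L' : List (Word A)} (h : L.Perm L') :
    coeff L f = coeff L' f := by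
  -- An arbitrary prefix is carried along, so that in the `cons` case the head can be moved into it.
  suffices key : ∀ U : List (Word A), coeff (U ++ L) f = coeff (U ++ L') f from key []
  induction h with
  | nil => exact fun _ => rfl
  | cons w _ ih => exact fun U => by simpa using ih (U ++ [w])
  | swap v w L => exact fun U => coeff_append_swap hf U L w v
  | trans _ _ ih₁ ih₂ => exact fun U => (ih₁ U).trans (ih₂ U)

theorem coeff_filter (L : List (Word A)) (f : QSymA A) :
    coeff (L.filter fun w => !w.isEmpty) f = coeff L f :=
  coeff_congr (by simp) f

/-- As multisets, the words of a flattening are the images of the support, and `σ` carries the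
support of `L` onto that of `K`. -/
theorem WSent.flatten_perm {K L : WSent A} (σ : Equiv.Perm ℕ)
    (h : ∀ i, L.word i = K.word (σ i)) : L.flatten.words.Perm K.flatten.words := by
  rw [← Multiset.coe_eq_coe]
  have hcoe : ∀ N : WSent A, (N.flatten.words : Multiset (Word A)) = N.supp.val.map N.word :=
    fun N => by
      rw [WSent.flatten, ← Multiset.map_coe, Finset.sort_eq]
  have hsupp : L.supp.map σ.toEmbedding = K.supp := by
    ext i
    simp [WSent.mem_supp, h]
  rw [hcoe, hcoe, ← hsupp, Finset.map_val, Multiset.map_map]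
  exact Multiset.map_congr rfl fun i _ => h i

/-! ### Homogeneous colored symmetric functions -/

/-- At `K` only the component of degree `K.size` can have a nonzero coefficient. Hence the
components of a sum can be recovered from it. -/
theorem coeLinearMap_homogeneous_apply (x : DirectSum ℕ fun n => SymA.homogeneous A n)
    (K : WSent A) :
    (DirectSum.coeLinearMap (SymA.homogeneous A) x).1.1 K = (x K.size).1.1.1 K := by
  classical
  induction x using DirectSum.induction_on with
  | zero => rw [LinearMap.map_zero]; rfl
  | of n f =>
    rw [DirectSum.coeLinearMap_of]
    by_cases h : n = K.size
    · subst h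
      rw [DirectSum.of_eq_same]
    · rw [DirectSum.of_eq_of_ne _ _ _ (Ne.symm h)]
      exact of_not_not fun h1 => h (f.2 K h1).symm
  | add x y hx hy =>
    rw [LinearMap.map_add, DirectSum.add_apply]
    exact congrArg₂ (· + ·) hx hy

theorem gradedMonoid_homogeneous : SetLike.GradedMonoid (SymA.homogeneous A) where
  one_mem K hK := by
    classical
    have h : K = 1 := of_not_not fun h => hK (if_neg h)
    rw [h]
    simp [WSent.size, WSent.one_apply]
  mul_mem i j f g hf hg K hK := by
    obtain ⟨p, hp, hne⟩ := Finset.exists_ne_zero_of_sum_ne_zero hK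
    rw [← mem_factor.1 hp, WSent.size_mul, hf _ (left_ne_zero_of_mul hne),
      hg _ (right_ne_zero_of_mul hne)]

section PSent

variable [LinearOrder A]

/-! ### Sorting -/

theorem gl_antisymm {v w : Word A} (h1 : gl v w) (h2 : gl w v) : v = w := by
  unfold gl at h1 h2
  rcases h1 with h1 | ⟨h1, h1'⟩ <;> rcases h2 with h2 | ⟨h2, h2'⟩
  · omega
  · omega
  · omega
  · exact le_antisymm h1' h2'

/-- The graded lexicographic order is antisymmetric, so a multiset of words has only one sorted
arrangement. -/
theorem PSent.ext_perm {P Q : PSent A} (h : P.words.Perm Q.words) : P = Q :=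
  PSent.ext (h.eq_of_pairwise (fun _ _ _ _ h1 h2 => gl_antisymm h2 h1) P.sorted Q.sorted)

theorem sort_words_perm (L : List (Word A)) :
    (sort L).words.Perm (L.filter fun w => !w.isEmpty) :=
  List.perm_insertionSort _ _

theorem sort_eq_iff {L : List (Word A)} {P : PSent A} :
    sort L = P ↔ (L.filter fun w => !w.isEmpty).Perm P.words :=
  ⟨fun h => h ▸ (sort_words_perm L).symm, fun h => PSent.ext_perm ((sort_words_perm L).trans h)⟩

theorem PSent.filter_words (P : PSent A) : P.words.filter (fun w => !w.isEmpty) = P.words :=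
  Sent.filter_words ⟨P.words, P.nil_notMem⟩

theorem sort_words (P : PSent A) : sort P.words = P :=
  sort_eq_iff.2 (by rw [P.filter_words])

theorem sort_filter (L : List (Word A)) : sort (L.filter fun w => !w.isEmpty) = sort L := by
  simp [sort]

theorem sort_eq_of_perm {L L' : List (Word A)} (h : L.Perm L') : sort L = sort L' :=
  sort_eq_iff.2 ((h.filter _).trans (sort_words_perm L').symm)

theorem sort_nil : sort ([] : List (Word A)) = PSent.empty := rfl

theorem coeff_sort {f : QSymA A} (hf : f ∈ SymA A) (L : List (Word A)) :
    coeff (sort L).words f = coeff L f :=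
  (coeff_perm hf (sort_words_perm L)).trans (coeff_filter L f)

/-- The size of a p-sentence: its number of letters. -/
def PSent.size (P : PSent A) : ℕ := (P.words.map List.length).sum

theorem WSent.size_sort (K : WSent A) : (sort K.flatten.words).size = K.size := by
  rw [← K.size_flatten, PSent.size, Sent.size]
  refine ((sort_words_perm K.flatten.words).map List.length).sum_eq.trans ?_
  rw [Sent.filter_words]

/-! ### Submultisets of p-sentences -/

theorem PSent.coe_remove (P Q : PSent A) :
    ((P.remove Q).words : Multiset (Word A)) = P.words - Q.words := by
  rw [Multiset.coe_sub]
  refine congrArg Multiset.ofList ?_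
  dsimp only [PSent.remove]
  congr 1
  -- The two list differences use different Boolean equality tests on words; both are lawful, hence
  -- equal.
  exact lawful_beq_subsingleton (α := Word A) List.instBEq instBEqOfDecidableEq

/-- In multisets of nonempty words this says that `a + b = p` exactly when `a ≤ p` and `b = p - a`.
It is the combinatorial content of the coproduct formula. -/
theorem sort_append_eq_iff (L L' : List (Word A)) (P : PSent A) :
    sort (L ++ L') = P ↔ (sort L).Sub P ∧ sort L' = P.remove (sort L) := by
  rw [sort_eq_iff, List.filter_append, sort_eq_iff, PSent.Sub,
    ← Multiset.coe_eq_coe, ← Multiset.coe_eq_coe, ← Multiset.coe_add, PSent.coe_remove,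
    Multiset.coe_eq_coe.2 (sort_words_perm L)]
  constructor
  · intro h
    rw [← h]
    exact ⟨Multiset.le_add_right _ _, (add_tsub_cancel_left _ _).symm⟩
  · rintro ⟨h1, h2⟩
    rw [h2]
    exact add_tsub_cancel_of_le h1

theorem PSent.sub_refl (P : PSent A) : P.Sub P := le_refl (P.words : Multiset (Word A))

theorem PSent.remove_self (P : PSent A) : P.remove P = PSent.empty :=
  PSent.ext <| (Multiset.coe_eq_zero _).1 <| by rw [PSent.coe_remove, tsub_self]

theorem PSent.Sub.length_lt {P Q : PSent A} (h : Q.Sub P) (hne : Q ≠ P) :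
    Q.words.length < P.words.length := by
  have h' : (Q.words : Multiset (Word A)) < P.words :=
    lt_of_le_of_ne h fun h1 => hne (PSent.ext_perm (Multiset.coe_eq_coe.1 h1))
  simpa using Multiset.card_lt_card h'

theorem PSent.size_remove {P Q : PSent A} (h : Q.Sub P) : Q.size + (P.remove Q).size = P.size := by
  have h1 : (Q.words ++ (P.remove Q).words).Perm P.words := by
    rw [← Multiset.coe_eq_coe, ← Multiset.coe_add, PSent.coe_remove]
    exact add_tsub_cancel_of_le h
  simpa [PSent.size] using (h1.map List.length).sum_eq

/-! ### The monomial basis -/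

-- Among the sentences summed in `m P`, only the one obtained from `L` by dropping empty words can
-- contribute.
open Classical in
theorem coeff_m (L : List (Word A)) (P : PSent A) :
    coeff L (m P) = if sort L = P then 1 else 0 := by
  rw [m, show (∑ᶠ (I : Sent A) (_ : sort I.words = P), M I) = _ from
    finsum_mem_eq_finite_toFinset_sum _ (finite_sort_eq P), map_sum]
  let J : Sent A := ⟨L.filter fun w => !w.isEmpty, by simp⟩
  have hJ : ∀ I : Sent A, coeff L (M I) = if J = I then 1 else 0 := fun I => by
    rw [coeff_M]
    by_cases h : J = I
    · simp [← h, J]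
    · have h' : ¬ (L.filter fun w => !w.isEmpty) = I.words := fun h' => h (Sent.ext h')
      simp [h, h']
  simp only [hJ, Finset.sum_ite_eq, Set.Finite.mem_toFinset]
  exact if_congr (by rw [← sort_filter L]; rfl) rfl rfl

theorem m_mem_sym (P : PSent A) : m P ∈ SymA A := by
  classical
  intro σ K L h
  rw [← coeff_flatten, ← coeff_flatten, coeff_m, coeff_m,
    sort_eq_of_perm (WSent.flatten_perm σ h)]

theorem m_empty : m (PSent.empty : PSent A) = 1 := by
  classical
  refine qsym_ext fun L => ?_
  rw [coeff_m, coeff_one]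
  exact if_congr (sort_eq_iff.trans List.perm_nil) rfl rfl

theorem counitQ_m (P : PSent A) (hP : P ≠ PSent.empty) : counitQ A (m P) = 0 := by
  classical
  rw [counitQ_eq_coeff, coeff_m, sort_nil, if_neg hP.symm]

/-- The functions `m P` form a basis of the colored symmetric functions. -/
def basisSym (A : Type*) [Finite A] [LinearOrder A] : Module.Basis (PSent A) ℚ (SymA A) :=
  .ofRepr
    { toFun := fun f => Finsupp.ofSupportFinite (fun P => coeff P.words f.1) <| by
        -- The p-sentences embed into the sentences, and the coordinates in the basis `M` are
        -- finitely supported.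
        refine Set.Finite.preimage (f := fun P : PSent A => (⟨P.words, P.nil_notMem⟩ : Sent A))
          (fun P _ Q _ h => PSent.ext (congrArg Sent.words h))
          ((basisM A).repr f.1).hasFiniteSupport
      map_add' := fun f g => by ext P; rfl
      map_smul' := fun c f => by ext P; rfl
      invFun := fun c => ⟨⟨fun K => c (sort K.flatten.words),
        ⟨c.support.sup PSent.size, fun K hK => by
          rw [← K.size_sort]
          exact Finset.le_sup (f := PSent.size) (Finsupp.mem_support_iff.2 hK)⟩,
        fun K L h => by simp only [h]⟩, fun σ K L h => by
          change c (sort K.flatten.words) = c (sort L.flatten.words)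
          rw [sort_eq_of_perm (WSent.flatten_perm σ h)]⟩
      left_inv := fun f => Subtype.ext <| Subtype.ext <| funext fun K => by
        exact (coeff_sort f.2 K.flatten.words).trans (coeff_flatten K f.1)
      right_inv := fun c => by
        ext P
        change c (sort (WSent.ofList P.words).flatten.words) = c P
        rw [WSent.flatten_ofList, sort_filter, sort_words] }

variable [Finite A]

theorem basisSym_repr (f : SymA A) (P : PSent A) : (basisSym A).repr f P = coeff P.words f := rfl

theorem basisSym_apply (P : PSent A) : (basisSym A P : QSymA A) = m P := by
  classical
  refine congrArg Subtype.val (a₂ := (⟨m P, m_mem_sym P⟩ : SymA A))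
    ((basisSym A).repr.injective ?_)
  ext Q
  rw [Module.Basis.repr_self, basisSym_repr, coeff_m, sort_words, Finsupp.single_apply]
  simp only [eq_comm]

/-! ### Product -/

/-- The coordinate at `Q` is the coefficient at `Q.words`; each factorization contributes 1 if its
factors sort to `P` and `T`, and 0 otherwise. -/
theorem repr_basisSym_mul (P T Q : PSent A) :
    (basisSym A).repr (basisSym A P * basisSym A T) Q = r P T Q := by
  classical
  rw [basisSym_repr, show ((basisSym A P * basisSym A T : SymA A) : QSymA A) = m P * m T by
    rw [← basisSym_apply, ← basisSym_apply]; rfl, coeff_mul]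
  have hset : concatPairs P T Q =
      ((listFactor Q.words).filter fun p => sort p.1 = P ∧ sort p.2 = T : Finset _) := by
    ext p
    simp only [concatPairs, Set.mem_ofPred_eq, Finset.coe_filter, mem_listFactor]
    tauto
  rw [r, hset, Set.ncard_coe_finset, Finset.card_filter, Nat.cast_sum]
  refine Finset.sum_congr rfl fun p _ => ?_
  rw [coeff_m, coeff_m, ite_and]
  split_ifs <;> simp

/-- These numbers are the coordinates of a single element, hence finitely supported. -/
theorem finite_r_ne_zero (P T : PSent A) : {Q : PSent A | r P T Q ≠ 0}.Finite := by
  refine ((basisSym A).repr (basisSym A P * basisSym A T)).hasFiniteSupport.subset fun Q hQ => ?_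
  rw [Function.mem_support, repr_basisSym_mul]
  exact Nat.cast_ne_zero.2 hQ

theorem basisSym_mul (P T : PSent A) :
    basisSym A P * basisSym A T = ∑ᶠ Q : PSent A, (r P T Q : ℚ) • basisSym A Q := by
  rw [← (basisSym A).linearCombination_repr (basisSym A P * basisSym A T),
    Finsupp.linearCombination_apply, Finsupp.sum, finsum_eq_sum_of_support_subset
      (s := ((basisSym A).repr (basisSym A P * basisSym A T)).support)]
  · simp only [repr_basisSym_mul]
  · intro Q hQ
    rw [Finset.mem_coe, Finsupp.mem_support_iff, repr_basisSym_mul]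
    intro h
    rw [Function.mem_support, h, zero_smul] at hQ
    exact hQ rfl

/-! ### Coproduct -/

theorem comulQ_m (P : PSent A) :
    comulQ A (m P) = ∑ Q ∈ (finite_sub P).toFinset, m Q ⊗ₜ[ℚ] m (P.remove Q) := by
  classical
  refine qsym_tensor_ext fun L L' => ?_
  rw [tensorFunctional_comulQ, map_sum, coeff_m]
  simp only [tensorFunctional_tmul, coeff_m, ite_mul, one_mul, zero_mul, Finset.sum_ite_eq,
    Set.Finite.mem_toFinset]
  rw [if_congr (sort_append_eq_iff L L' P) rfl rfl, ite_and]
  rfl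

/-- The comultiplication of the colored symmetric functions. -/
def comulSym (A : Type*) [Finite A] [LinearOrder A] : SymA A →ₗ[ℚ] SymA A ⊗[ℚ] SymA A :=
  (basisSym A).constr ℚ fun P =>
    ∑ Q ∈ (finite_sub P).toFinset, basisSym A Q ⊗ₜ[ℚ] basisSym A (P.remove Q)

theorem comulSym_basisSym (P : PSent A) : comulSym A (basisSym A P) =
    ∑ Q ∈ (finite_sub P).toFinset, basisSym A Q ⊗ₜ[ℚ] basisSym A (P.remove Q) := by
  rw [comulSym, Module.Basis.constr_basis]

theorem map_comulSym (f : SymA A) :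
    TensorProduct.map (SymA A).val.toLinearMap (SymA A).val.toLinearMap (comulSym A f) =
      comulQ A f := by
  suffices h : TensorProduct.map (SymA A).val.toLinearMap (SymA A).val.toLinearMap ∘ₗ comulSym A =
      comulQ A ∘ₗ (SymA A).val.toLinearMap from LinearMap.congr_fun h f
  refine (basisSym A).ext fun P => ?_
  simp only [LinearMap.comp_apply, comulSym_basisSym, map_sum, TensorProduct.map_tmul,
    AlgHom.toLinearMap_apply, Subalgebra.coe_val, basisSym_apply, comulQ_m]

/-! ### Antipode -/

/-- Induction on the number of words: the antipode axiom at `m P` writes the antipode of `m P` as a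
constant minus products of antipodes of shorter `m Q` with symmetric functions. -/
theorem antipodeQ_m_mem_sym (P : PSent A) : antipodeQ A (m P) ∈ SymA A := by
  classical
  induction hn : P.words.length using Nat.strong_induction_on generalizing P with
  | _ n ih =>
    have h := LinearMap.congr_fun (mul_antipodeQ_rTensor_comulQ (A := A)) (m P)
    simp only [LinearMap.comp_apply, comulQ_m, map_sum, LinearMap.rTensor_tmul,
      LinearMap.mul'_apply] at h
    have hP : P ∈ (finite_sub P).toFinset := (Set.Finite.mem_toFinset _).2 P.sub_refl
    -- The summand `Q = P` has second factor `m PSent.empty = 1`, which isolates the antipode of `m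
    -- P`.
    rw [← Finset.add_sum_erase _ _ hP, P.remove_self,
      m_empty, mul_one] at h
    rw [eq_sub_of_add_eq h]
    refine sub_mem ((SymA A).algebraMap_mem _) (sum_mem fun Q hQ => ?_)
    rw [Finset.mem_erase, Set.Finite.mem_toFinset] at hQ
    exact mul_mem (ih _ (hn ▸ hQ.2.length_lt hQ.1) Q rfl) (m_mem_sym _)

theorem antipodeQ_mem_sym (f : SymA A) : antipodeQ A f ∈ SymA A := by
  have h := (basisSym A).linearCombination_repr f
  rw [Finsupp.linearCombination_apply, Finsupp.sum] at h
  rw [← h, AddSubmonoidClass.coe_finsetSum, map_sum]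
  refine sum_mem fun P _ => ?_
  rw [SetLike.val_smul, map_smul, basisSym_apply]
  exact (SymA A).smul_mem (antipodeQ_m_mem_sym P) _

/-- The antipode of the colored symmetric functions. -/
def antipodeSym (A : Type*) [Finite A] [LinearOrder A] : SymA A →ₗ[ℚ] SymA A where
  toFun f := ⟨antipodeQ A f, antipodeQ_mem_sym f⟩
  map_add' f g := Subtype.ext (map_add (antipodeQ A) f.1 g.1)
  map_smul' c f := Subtype.ext (map_smul (antipodeQ A) c f.1)

theorem isHopfSubalgebra_sym : IsHopfSubalgebra (SymA A) (comulQ A) (counitQ A) (antipodeQ A)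
    (comulSym A) (counitQ A ∘ₗ (SymA A).val.toLinearMap) (antipodeSym A) where
  comul_restrict := map_comulSym
  counit_restrict _ := rfl
  antipode_restrict _ := rfl

/-! ### Grading -/

theorem basisSym_mem_homogeneous (P : PSent A) :
    basisSym A P ∈ SymA.homogeneous A P.size := by
  classical
  intro K hK
  rw [← coeff_flatten, basisSym_apply, coeff_m] at hK
  rw [← K.size_sort, of_not_not fun h => hK (if_neg h)]

theorem size_of_repr_ne_zero {n : ℕ} {f : SymA A} (hf : f ∈ SymA.homogeneous A n) {P : PSent A}
    (hP : (basisSym A).repr f P ≠ 0) : P.size = n := by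
  rw [← hf _ hP, ← WSent.size_sort, WSent.flatten_ofList, sort_filter, sort_words]

theorem isInternal_homogeneous : DirectSum.IsInternal (SymA.homogeneous A) := by
  classical
  constructor
  · intro x y hxy
    refine DFinsupp.ext fun n => Subtype.ext (Subtype.ext (Subtype.ext (funext fun K => ?_)))
    -- In size `n` the coefficient of the `n`-th component is that of the whole sum; in every other
    -- size it vanishes.
    by_cases hn : K.size = n
    · subst hn
      refine (coeLinearMap_homogeneous_apply x K).symm.trans
        (Eq.trans ?_ (coeLinearMap_homogeneous_apply y K))
      exact congrArg (fun f : SymA A => f.1.1 K) hxy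
    · have h0 : ∀ f : SymA.homogeneous A n, f.1.1.1 K = 0 := fun f =>
        of_not_not fun h => hn (f.2 K h)
      rw [h0, h0]
  · refine LinearMap.range_eq_top (f := DirectSum.coeLinearMap (SymA.homogeneous A)).1 ?_
    rw [← top_le_iff, ← (basisSym A).span_eq, Submodule.span_le]
    rintro _ ⟨P, rfl⟩
    exact ⟨DirectSum.of (fun n => SymA.homogeneous A n) P.size ⟨_, basisSym_mem_homogeneous P⟩,
      DirectSum.coeLinearMap_of _ _ _⟩

/-- Only basis elements of size `n` occur in `f`, and splitting the words of `P` between `Q` and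
`P.remove Q` splits its size. -/
theorem comulSym_mem (n : ℕ) (f : SymA A) (hf : f ∈ SymA.homogeneous A n) :
    comulSym A f ∈ ⨆ p ∈ Finset.HasAntidiagonal.antidiagonal n,
      LinearMap.range (TensorProduct.map (SymA.homogeneous A p.1).subtype
        (SymA.homogeneous A p.2).subtype) := by
  rw [← (basisSym A).linearCombination_repr f, Finsupp.linearCombination_apply, Finsupp.sum,
    map_sum]
  refine sum_mem fun P hP => ?_
  rw [map_smul, comulSym_basisSym]
  refine Submodule.smul_mem _ _ (sum_mem fun Q hQ => ?_)
  rw [Set.Finite.mem_toFinset] at hQ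
  have hsize : Q.size + (P.remove Q).size = n :=
    (PSent.size_remove hQ).trans (size_of_repr_ne_zero hf (Finsupp.mem_support_iff.1 hP))
  refine Submodule.mem_iSup_of_mem (Q.size, (P.remove Q).size)
    (Submodule.mem_iSup_of_mem (Finset.HasAntidiagonal.mem_antidiagonal.2 hsize) ?_)
  exact ⟨⟨_, basisSym_mem_homogeneous Q⟩ ⊗ₜ ⟨_, basisSym_mem_homogeneous (P.remove Q)⟩, rfl⟩

instance : Module.Flat ℚ (QSymA A) := .of_free

instance : Module.Flat ℚ (SymA A) := .of_free

theorem isHopfAlgebra_sym : IsHopfAlgebra (comulSym A)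
    (counitQ A ∘ₗ (SymA A).val.toLinearMap) (antipodeSym A) :=
  have h := IsHopfSubalgebra.isHopfAlgebra (G := SymA A) (Δ := comulQ A) (ε := counitQ A)
    (S := antipodeQ A) (Δ' := comulSym A) (ε' := counitQ A ∘ₗ (SymA A).val.toLinearMap)
    (S' := antipodeSym A) isHopfSubalgebra_sym
  h isHopfAlgebra_qsym

theorem isGradedHopfAlgebra_sym : IsGradedHopfAlgebra (SymA.homogeneous A) (comulSym A)
    (counitQ A ∘ₗ (SymA A).val.toLinearMap) (antipodeSym A) where
  toIsHopfAlgebra := isHopfAlgebra_sym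
  isInternal := isInternal_homogeneous
  gradedMonoid := gradedMonoid_homogeneous
  comul_mem := comulSym_mem

end PSent

end
end ColoredSym

end

open ColoredSym in
theorem mainTheorem2 (A : Type*) [Finite A] [LinearOrder A] :
    ∃ (antipodeQ : QSymA A →ₗ[ℚ] QSymA A)
      (b : Module.Basis (PSent A) ℚ (SymA A))
      (Δ : SymA A →ₗ[ℚ] SymA A ⊗[ℚ] SymA A) (ε : SymA A →ₗ[ℚ] ℚ) (S : SymA A →ₗ[ℚ] SymA A),
      IsHopfAlgebra (comulQ A) (counitQ A) antipodeQ ∧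
      (∀ P : PSent A, (b P : QSymA A) = m P) ∧
      IsGradedHopfAlgebra (SymA.homogeneous A) Δ ε S ∧
      IsHopfSubalgebra (SymA A) (comulQ A) (counitQ A) antipodeQ Δ ε S ∧
      (∀ P T : PSent A, {Q : PSent A | r P T Q ≠ 0}.Finite ∧
        b P * b T = ∑ᶠ Q : PSent A, (r P T Q : ℚ) • b Q) ∧
      (∀ k : ℚ, algebraMap ℚ (SymA A) k = k • 1) ∧
      (∀ P : PSent A, Δ (b P) = ∑ᶠ (Q : PSent A) (_ : Q.Sub P), b Q ⊗ₜ[ℚ] b (P.remove Q)) ∧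
      ε (b PSent.empty) = 1 ∧ (∀ P : PSent A, P ≠ PSent.empty → ε (b P) = 0) := by
  refine ⟨antipodeQ A, basisSym A, comulSym A, counitQ A ∘ₗ (SymA A).val.toLinearMap,
    antipodeSym A, isHopfAlgebra_qsym, basisSym_apply, isGradedHopfAlgebra_sym,
    isHopfSubalgebra_sym, fun P T => ⟨finite_r_ne_zero P T, basisSym_mul P T⟩,
    Algebra.algebraMap_eq_smul_one, fun P => ?_, ?_, fun P hP => ?_⟩
  · rw [comulSym_basisSym]
    exact (finsum_mem_eq_finite_toFinset_sum _ (finite_sub P)).symm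
  · change counitQ A (basisSym A PSent.empty : QSymA A) = 1
    rw [basisSym_apply, m_empty, counitQ_one]
  · change counitQ A (basisSym A P : QSymA A) = 0
    rw [basisSym_apply, counitQ_m P hP]
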